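/- Let $q\in\mathbb C$ be a root of unity with $q^4\neq 1$. Put $n=\operatorname{ord}(q^2)$, $N=\operatorname{ord}(q^4)$, $\epsilon=q^{N^2}$ and $D=n$ (so $D=N$ if $n$ is odd and $D=2N$ if $n$ is even). Let $T_k$ be the polynomial with $T_k(x+x^{-1})=x^k+x^{-k}$. Let $\mathcal S$ be the Kauffman bracket skein algebra of the one-punctured torus, i.e. the $\mathbb C$-algebra generated by the curves $\alpha_0,\alpha_1,\alpha_\infty$ of slopes $0,1,\infty$ with relations $$q\alpha_0\alpha_\infty-q^{-1}\alpha_\infty\alpha_0=(q^2-q^{-2})\alpha_1,\quad q\alpha_1\alpha_0-q^{-1}\alpha_0\alpha_1=(q^2-q^{-2})\alpha_\infty,\quad q\alpha_\infty\alpha_1-q^{-1}\alpha_1\alpha_\infty=(q^2-q^{-2})\alpha_0,$$ let $p=q\alpha_0\alpha_\infty\alpha_1-q^2\alpha_0^2-q^2\alpha_1^2-q^{-2}\alpha_\infty^2+q^2+q^{-2}$ be the peripheral curve, and let $Z$ be the center of $\mathcal S$. The elements $A_m=T_D(\alpha_m)$, $m\in\{0,1,\infty\}$, and $p$ lie in $Z$.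 Call $z_0\in\mathbb C$ general if $z_0\ne\pm2$, or $z_0=-2$ and $n$ is even. Given $w\in\mathbb C$ and $\sigma\in\mathbb C^\times$ with $z_0=\sigma^D+\sigma^{-D}$ general, put $\lambda_i=q^{2i}\sigma+q^{-2i}\sigma^{-1}$, $\hat\lambda_i=q^{2i}\sigma-q^{-2i}\sigma^{-1}$ and $r_i=(w+q^{4i+2}\sigma^2+q^{-4i-2}\sigma^{-2})/(\hat\lambda_i\hat\lambda_{i+1})$. Given complex numbers $s_i,t_i$ $(i\in\mathbb Z/D)$ with $s_it_i=r_i$ for all $i$, the type-$0$ representation $\rho:\mathcal S\to\operatorname{End}(V)$ on a complex vector space $V$ with basis $\{v_i\}_{i\in\mathbb Z/D}$ is given by $$\rho(\alpha_0)v_i=\lambda_iv_i,\quad \rho(\alpha_1)v_i=q^{2i+1}\sigma s_iv_{i+1}+q^{-2i+1}\sigma^{-1}t_{i-1}v_{i-1},\quad \rho(\alpha_\infty)v_i=s_iv_{i+1}+t_{i-1}v_{i-1}.$$ Write $\Pi_s=\prod_{i=1}^Ds_i$, $\Pi_t=\prod_{i=1}^Dt_i$. A representation $\rho$ has classical shadow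 $\chi$, where $\chi:Z\to\mathbb C$ is an algebra homomorphism (a point of $\operatorname{MaxSpec}Z$), if $\rho(x)=\chi(x)\,\mathrm{id}_V$ for all $x\in Z$. 1. Every type-$0$ representation $\rho$ has a classical shadow, and $A_1,A_\infty$ act as the following scalars. If $n$ is odd, $$\rho(A_1)=\epsilon\sigma^D\Pi_s+\epsilon\sigma^{-D}\Pi_t,\qquad \rho(A_\infty)=\Pi_s+\Pi_t.$$ If $n$ is even, $$\rho(A_1)=\sigma^D\Pi_s+\sigma^{-D}\Pi_t+f,\qquad \rho(A_\infty)=\Pi_s+\Pi_t+f,\qquad f=\frac{2\epsilon^2T_N(w)+4}{z_0-2}.$$ 2. Every point $\chi$ of $\operatorname{MaxSpec}Z$ such that $\chi(A_0)$ is general is the classical shadow of some type-$0$ representation. Equivalently in the coordinates $(A_0,A_1,A_\infty,p)$: for every $(z_0,z_1,z_\infty,w)\in\mathbb C^4$ with $z_0$ general satisfying $$z_0^2+z_1^2+z_\infty^2-\epsilon z_0z_\infty z_1+T_N(w)-2=0\quad(n\text{ odd}),$$ $$(z_0+2)(z_1+2)(z_\infty+2)=(z_0+z_1+z_\infty+\epsilon^2T_N(w)+4)^2\quad(n\text{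 even}),$$ there is a type-$0$ representation (with this $w$) whose classical shadow takes the values $z_0,z_1,z_\infty,w$ on $A_0,A_1,A_\infty,p$. -/

import Mathlib

noncomputable section

namespace PuncturedTorus

/-- The slopes of the three standard simple closed curves on the one-punctured torus
`(ℝ² ∖ ℤ²) / ℤ²`. -/
inductive Slope : Type
  | zero : Slope
  | one : Slope
  | infty : Slope

/-- The free generator attached to a slope. -/
abbrev gen (m : Slope) : FreeAlgebra ℂ Slope := FreeAlgebra.ι ℂ m

/-- The Bullock--Przytycki relations between the curves of slopes `0`, `1`, `∞`. -/
inductive SkeinRel (q : ℂ) : FreeAlgebra ℂ Slope → FreeAlgebra ℂ Slope → Prop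
  | rel_one : SkeinRel q
      (q • (gen .zero * gen .infty) - q⁻¹ • (gen .infty * gen .zero))
      ((q ^ 2 - q⁻¹ ^ 2) • gen .one)
  | rel_infty : SkeinRel q
      (q • (gen .one * gen .zero) - q⁻¹ • (gen .zero * gen .one))
      ((q ^ 2 - q⁻¹ ^ 2) • gen .infty)
  | rel_zero : SkeinRel q
      (q • (gen .infty * gen .one) - q⁻¹ • (gen .one * gen .infty))
      ((q ^ 2 - q⁻¹ ^ 2) • gen .zero)

/-- The Kauffman bracket skein algebra of the one-punctured torus over `ℂ`, in its standard
presentation. -/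
abbrev Skein (q : ℂ) : Type := RingQuot (SkeinRel q)

/-- The simple closed curve of slope `m`, as an element of the skein algebra. -/
def curve (q : ℂ) (m : Slope) : Skein q := RingQuot.mkAlgHom ℂ (SkeinRel q) (gen m)

/-- The peripheral curve `p`. -/
def peripheral (q : ℂ) : Skein q :=
  q • (curve q .zero * curve q .infty * curve q .one) - q ^ 2 • curve q .zero ^ 2
    - q ^ 2 • curve q .one ^ 2 - q⁻¹ ^ 2 • curve q .infty ^ 2
    + algebraMap ℂ (Skein q) (q ^ 2 + q⁻¹ ^ 2)

/-- The center `Z` of the skein algebra. -/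
abbrev Center (q : ℂ) : Subalgebra ℂ (Skein q) := Subalgebra.center ℂ (Skein q)

/-- `n`, the order of `q²`. For the one-punctured torus this is also the PI degree `D` of the
skein algebra: with `N = ord(q⁴)`, one has `D = N` for `n` odd and `D = 2N` for `n` even. -/
def ordTwo (q : ℂ) : ℕ := orderOf (q ^ 2)

/-- `N`, the order of `q⁴`. -/
def ordFour (q : ℂ) : ℕ := orderOf (q ^ 4)

/-- `ε = q ^ (N²)`. -/
def eps (q : ℂ) : ℂ := q ^ (ordFour q ^ 2)

/-- The Chebyshev polynomial with `T_k(t + t⁻¹) = t ^ k + t⁻¹ ^ k`, that is `T_0 = 2`, `T_1 = X`,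
`T_{k+2} = X T_{k+1} - T_k`. -/
def cheb (k : ℕ) : Polynomial ℂ := Polynomial.Chebyshev.C ℂ (k : ℤ)

/-- `A_m = T_D(α_m)`. -/
def threadedCurve (q : ℂ) (m : Slope) : Skein q := Polynomial.aeval (curve q m) (cheb (ordTwo q))

/-- `T_N(w)`. -/
def chebN (q w : ℂ) : ℂ := (cheb (ordFour q)).eval w

/-- `z₀ = σ ^ D + σ ^ (-D)`. -/
def zZero (q σ : ℂ) : ℂ := σ ^ ordTwo q + σ⁻¹ ^ ordTwo q

/-- `z₀` is general: `z₀ ≠ ±2`, or `z₀ = -2` and `n` is even. -/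
def IsGeneral (q z₀ : ℂ) : Prop :=
  (z₀ ≠ 2 ∧ z₀ ≠ -2) ∨ (z₀ = -2 ∧ Even (ordTwo q))

/-- `λ_i = q^{2i} σ + q^{-2i} σ⁻¹`, for an integer `i`; it is `D`-periodic in `i`. -/
def lam (q σ : ℂ) (i : ℤ) : ℂ := q ^ (2 * i) * σ + q ^ (-2 * i) * σ⁻¹

/-- `λ̂_i = q^{2i} σ - q^{-2i} σ⁻¹`, for an integer `i`; it is `D`-periodic in `i`. -/
def lamHat (q σ : ℂ) (i : ℤ) : ℂ := q ^ (2 * i) * σ - q ^ (-2 * i) * σ⁻¹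

/-- `r_i(σ, w) = (w + q^{4i+2} σ² + q^{-4i-2} σ⁻²) / (λ̂_i λ̂_{i+1})`. The denominator is nonzero
when `q` is a nontrivial root of unity, `σ ≠ 0` and `z₀` is general. -/
def rCoeff (q σ w : ℂ) (i : ℤ) : ℂ :=
  (w + q ^ (4 * i + 2) * σ ^ 2 + q ^ (-4 * i - 2) * σ⁻¹ ^ 2) / (lamHat q σ i * lamHat q σ (i + 1))

/-- The set `E⁰_{σ,w}` of pairs `(s, t)` of vectors indexed by `ℤ/D` with `s_i t_i = r_i(σ, w)`. -/
def paramSet (q σ w : ℂ) : Set ((ZMod (ordTwo q) → ℂ) × (ZMod (ordTwo q) → ℂ)) :=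
  {e | ∀ i : ℤ, e.1 (i : ZMod (ordTwo q)) * e.2 (i : ZMod (ordTwo q)) = rCoeff q σ w i}

/-- The product `∏_{i=1}^D s_i`; it is `Π_s` for the vector `s` and `Π_t` for the vector `t`. -/
def cycleProd (q : ℂ) (s : ZMod (ordTwo q) → ℂ) : ℂ :=
  ∏ i ∈ Finset.Icc 1 (ordTwo q), s (i : ZMod (ordTwo q))

/-- The correction term `f(z₀, w) = (2 ε² T_N(w) + 4) / (z₀ - 2)`. -/
def corr (q z₀ w : ℂ) : ℂ := (2 * eps q ^ 2 * chebN q w + 4) / (z₀ - 2)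

/-- `ρ` is the type-`0` representation, on a space with basis `v_i`, `i ∈ ℤ/D`, with parameters
`σ`, `w` (`σ` nonzero and general) and `(s, t) ∈ E⁰_{σ,w}`. -/
structure IsTypeZero {V : Type*} [AddCommGroup V] [Module ℂ V] (q : ℂ)
    (v : Module.Basis (ZMod (ordTwo q)) ℂ V) (σ w : ℂ) (s t : ZMod (ordTwo q) → ℂ)
    (ρ : Skein q →ₐ[ℂ] Module.End ℂ V) : Prop where
  sigma_ne_zero : σ ≠ 0
  general : IsGeneral q (zZero q σ)
  mem_paramSet : (s, t) ∈ paramSet q σ w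
  apply_zero : ∀ i : ℤ, ρ (curve q .zero) (v i) = lam q σ i • v i
  apply_one : ∀ i : ℤ, ρ (curve q .one) (v i) =
    (q ^ (2 * i + 1) * σ * s i) • v (i + 1) + (q ^ (-2 * i + 1) * σ⁻¹ * t (i - 1)) • v (i - 1)
  apply_infty : ∀ i : ℤ, ρ (curve q .infty) (v i) = s i • v (i + 1) + t (i - 1) • v (i - 1)

/-- `χ` is the classical shadow of `ρ`: every central `x` acts as the scalar `χ x`. The points of
the shadow variety `MaxSpec Z` are the `ℂ`-algebra homomorphisms `Z → ℂ`. -/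
def IsClassicalShadow {V : Type*} [AddCommGroup V] [Module ℂ V] (q : ℂ)
    (ρ : Skein q →ₐ[ℂ] Module.End ℂ V) (χ : Center q →ₐ[ℂ] ℂ) : Prop :=
  ∀ x : Center q, ρ (x : Skein q) = χ x • (1 : Module.End ℂ V)

/-- The shadow variety as a closed subset of `ℂ⁴`, with coordinates `A_0, A_1, A_∞, p`. -/
def IsShadowPoint (q z₀ z₁ zi w : ℂ) : Prop :=
  (Odd (ordTwo q) → z₀ ^ 2 + z₁ ^ 2 + zi ^ 2 - eps q * z₀ * zi * z₁ + chebN q w - 2 = 0) ∧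
  (Even (ordTwo q) → (z₀ + 2) * (z₁ + 2) * (zi + 2)
    = (z₀ + z₁ + zi + eps q ^ 2 * chebN q w + 4) ^ 2)

end PuncturedTorus

end

/-!
Write `D` for the order of `q²`. The curves of slopes `0`, `∞`, `1` satisfy relations that are
invariant under cyclic rotation (`IsSkeinTriple`), so most facts are needed for one of them only.

**Central elements.** Left and right multiplication by `a = α₀`, restricted to the cyclic bimodule
generated by `b = α_∞`, satisfy a quadratic equation, the one satisfied by a pair
`x + x⁻¹`, `q² x + q⁻² x⁻¹` (`IsSkeinTriple.sq_mul`). Hence Chebyshev polynomials of `a` can be moved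
past `b` explicitly (`IsSkeinTriple.aeval_C_mul`), and `T_D(a)` commutes with `b`.

**Classical shadows.** If the eigenvalues of `ρ(α₀)` are distinct and no `s_i` vanishes, only scalars
commute with the image of a type-`0` representation. Every type-`0` representation is a limit of
such representations: keep `w`, move `σ`, and continue the factorization `r_i = s_i t_i`. So central
elements act as scalars in general (`IsTypeZero.exists_eq_smul_one`).

**The scalars.** `ρ(α_∞)` and `ρ(α₁)` are periodic Jacobi operators with the same ratios
`r_i = s_i t_i`. On the universal cover `ℤ` of the cycle, `T_D` of such an operator, applied to a
basis vector, reaches the `D`-th neighbours with coefficients `Π_s` and `Π_t`, and its coefficient at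
the starting point depends on the `r_i` only (`repr_aeval_cheb_hop`). That coefficient
(`innerCoeff`) vanishes for `D` odd, by parity. For `D` even it is computed from one choice of
`(s, t)`, for which the sum of the basis vectors is an eigenvector of `ρ(α_∞)` and all products are
products over roots of unity (`even_special`).

**Points of the shadow variety in coordinates.** The equation of the variety is the condition
`Π_s Π_t = ∏ r_i` on the solution `(Π_s, Π_t)` of the linear equations given by the values of `A_1`
and `A_∞`. When `z₀ = -2` these equations coincide, and a quadratic equation for `Π_s` is solved
instead (`exists_cycle_products_of_even`). Any two numbers with product `∏ r_i` are products of
factors with `s_i t_i = r_i` (`exists_prod_eq`).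

**Characters of the center.** The skein algebra is spanned by ordered monomials and each curve is
integral over the center, so the algebra is finite over its center, and by Nakayama's lemma a
character `χ` of the center is the central character of a nonzero finite dimensional representation
`M` (`exists_rep_of_center_character`). In `M`, the operators `ladder` permute the eigenspaces of
`α₀` as the shifts `v_i ↦ v_{i+1}` and `v_i ↦ v_{i-1}` do in a type-`0` representation. A suitable
eigenvector of `α₀` (`exists_cyclic_vector`) therefore generates the image of a nonzero intertwiner
from a type-`0` representation to `M` (`exists_intertwiner`), whose shadow must be `χ`.
-/

noncomputable section

namespace PuncturedTorus

open Polynomial Filter Topology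

/-! ### The relations of the skein algebra -/

/-- A triple of elements of an algebra satisfying the Bullock--Przytycki relations, written so that
the relations are invariant under the rotation `a ↦ b ↦ c ↦ a`. In the skein algebra
`(a, b, c) = (α₀, α_∞, α₁)`. -/
structure IsSkeinTriple {A : Type*} [Ring A] [Algebra ℂ A] (q : ℂ) (a b c : A) : Prop where
  ab : q • (a * b) - q⁻¹ • (b * a) = (q ^ 2 - q⁻¹ ^ 2) • c
  bc : q • (b * c) - q⁻¹ • (c * b) = (q ^ 2 - q⁻¹ ^ 2) • a
  ca : q • (c * a) - q⁻¹ • (a * c) = (q ^ 2 - q⁻¹ ^ 2) • b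

/-- The peripheral element of a triple of elements, written in the order `a, b, c`. -/
def peri {A : Type*} [Ring A] [Algebra ℂ A] (q : ℂ) (a b c : A) : A :=
  q • (a * b * c) - q ^ 2 • a ^ 2 - q ^ 2 • c ^ 2 - q⁻¹ ^ 2 • b ^ 2
    + algebraMap ℂ A (q ^ 2 + q⁻¹ ^ 2)

namespace IsSkeinTriple

variable {A : Type*} [Ring A] [Algebra ℂ A] {q : ℂ} {a b c : A}

theorem rotate (h : IsSkeinTriple q a b c) : IsSkeinTriple q b c a := ⟨h.bc, h.ca, h.ab⟩

theorem map {B : Type*} [Ring B] [Algebra ℂ B] (h : IsSkeinTriple q a b c) (f : A →ₐ[ℂ] B) :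
    IsSkeinTriple q (f a) (f b) (f c) := by
  constructor
  · simpa using congrArg f h.ab
  · simpa using congrArg f h.bc
  · simpa using congrArg f h.ca

theorem ba_eq (h : IsSkeinTriple q a b c) (hq : q ≠ 0) :
    b * a = q ^ 2 • (a * b) - (q * (q ^ 2 - q⁻¹ ^ 2)) • c := by
  rw [mul_smul q, ← h.ab]
  simp only [smul_sub, smul_smul, mul_inv_cancel₀ hq, one_smul]
  module

theorem ab_eq (h : IsSkeinTriple q a b c) (hq : q ≠ 0) :
    a * b = q⁻¹ ^ 2 • (b * a) + (q⁻¹ * (q ^ 2 - q⁻¹ ^ 2)) • c := by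
  rw [h.ba_eq hq]
  match_scalars
  · field_simp
  · field_simp
    ring

/-- The peripheral element is invariant under rotation of the triple. -/
theorem peri_rotate (h : IsSkeinTriple q a b c) (hq : q ≠ 0) : peri q b c a = peri q a b c := by
  have h1 : b * c * a = a * b * c - (q⁻¹ * (q ^ 2 - q⁻¹ ^ 2)) • c ^ 2
      + (q⁻¹ * (q ^ 2 - q⁻¹ ^ 2)) • b ^ 2 := by
    rw [mul_assoc, h.rotate.rotate.ab_eq hq, mul_add, mul_smul_comm, mul_smul_comm, ← mul_assoc,
      h.ba_eq hq, sub_mul, smul_mul_assoc, smul_mul_assoc, ← sq, ← sq]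
    match_scalars <;> field_simp
  rw [peri, peri, h1]
  match_scalars <;> field_simp <;> ring

theorem peri_commute (h : IsSkeinTriple q a b c) (hq : q ≠ 0) : Commute a (peri q a b c) := by
  have hca := h.rotate.rotate.ab_eq hq
  have hba := h.ba_eq hq
  have h1 : a * b * c * a = a * (a * b * c) - (q⁻¹ * (q ^ 2 - q⁻¹ ^ 2)) • (a * c ^ 2)
      + (q⁻¹ * (q ^ 2 - q⁻¹ ^ 2)) • (a * b ^ 2) := by
    have : a * b * c * a = a * (b * (c * a)) := by noncomm_ring
    rw [this, hca, mul_add, mul_smul_comm, mul_smul_comm, ← mul_assoc b,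
      hba, sub_mul, smul_mul_assoc, smul_mul_assoc, ← sq, ← sq]
    simp only [mul_add, mul_sub, mul_smul_comm, ← mul_assoc]
    match_scalars <;> field_simp
  have h2 : c ^ 2 * a = q⁻¹ ^ 4 • (a * c ^ 2) + (q⁻¹ ^ 3 * (q ^ 2 - q⁻¹ ^ 2)) • (b * c)
      + (q⁻¹ * (q ^ 2 - q⁻¹ ^ 2)) • (c * b) := by
    rw [sq, mul_assoc, hca, mul_add, mul_smul_comm, mul_smul_comm, ← mul_assoc, hca, add_mul]
    simp only [smul_mul_assoc, mul_assoc]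
    match_scalars <;> field_simp
  have h3 : b ^ 2 * a = q ^ 4 • (a * b ^ 2) - (q ^ 3 * (q ^ 2 - q⁻¹ ^ 2)) • (c * b)
      - (q * (q ^ 2 - q⁻¹ ^ 2)) • (b * c) := by
    rw [sq, mul_assoc, hba, mul_sub, mul_smul_comm, mul_smul_comm, ← mul_assoc, hba, sub_mul]
    simp only [smul_mul_assoc, mul_assoc]
    match_scalars <;> field_simp
  have h4 : a ^ 2 * a = a * a ^ 2 := by noncomm_ring
  rw [commute_iff_eq, peri]
  simp only [mul_add, mul_sub, add_mul, sub_mul, mul_smul_comm, smul_mul_assoc, h1, h2, h3, h4,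
    Algebra.commutes]
  match_scalars <;> field_simp <;> ring

/-- The quadratic relation between left and right multiplication by `a`, applied to `b`: it is the
equation `X² + Y² - (q² + q⁻²) X Y + (q² - q⁻²)² = 0`, which `X = x + x⁻¹` and `Y = q² x + q⁻² x⁻¹`
satisfy. -/
theorem sq_mul (h : IsSkeinTriple q a b c) (hq : q ≠ 0) :
    a * (a * b) = (q ^ 2 + q⁻¹ ^ 2) • (a * b * a) - b * a ^ 2 - (q ^ 2 - q⁻¹ ^ 2) ^ 2 • b := by
  have hca := h.rotate.rotate.ba_eq hq
  have h1 : b * a ^ 2 = q ^ 2 • (a * b * a) - (q * (q ^ 2 - q⁻¹ ^ 2)) • (c * a) := by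
    rw [sq a, ← mul_assoc, h.ba_eq hq, sub_mul, smul_mul_assoc, smul_mul_assoc]
  have h2 : a * (a * b) = q⁻¹ ^ 2 • (a * b * a) + (q⁻¹ * (q ^ 2 - q⁻¹ ^ 2)) • (a * c) := by
    conv_lhs => rw [h.ab_eq hq]
    rw [mul_add, mul_smul_comm, mul_smul_comm, mul_assoc]
  rw [h2, hca, h1]
  match_scalars
  · field_simp
    ring
  · field_simp
  · field_simp

theorem commute_aeval_self (p : ℂ[X]) : Commute (aeval a p) a := by
  simpa using (Commute.all p X).map (aeval a)

/-- The rule for moving Chebyshev polynomials of `a` past `b`. If `q ^ (2k) = 1`, then the first term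
on the right vanishes, and the other two combine to `b T_k(a)`, since `T_k = S_k - S_{k-2}`. -/
theorem aeval_C_mul (h : IsSkeinTriple q a b c) (hq : q ≠ 0) (k : ℕ) :
    (q ^ 2 - q⁻¹ ^ 2) • (aeval a (Chebyshev.C ℂ k) * b) =
      ((q ^ 2) ^ k - (q⁻¹ ^ 2) ^ k) • (a * b * aeval a (Chebyshev.S ℂ (k - 1)))
      - (q⁻¹ ^ 2 * (q ^ 2) ^ k - q ^ 2 * (q⁻¹ ^ 2) ^ k) • (b * aeval a (Chebyshev.S ℂ k))
      - (q ^ 2 * (q ^ 2) ^ k - q⁻¹ ^ 2 * (q⁻¹ ^ 2) ^ k) •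
          (b * aeval a (Chebyshev.S ℂ (k - 2))) := by
  induction k using Nat.twoStepInduction with
  | zero =>
    simp only [Nat.cast_zero, Chebyshev.C_zero, zero_sub, Chebyshev.S_neg_one, Chebyshev.S_zero,
      Chebyshev.S_neg_two, map_neg, map_one, map_zero, mul_zero, map_ofNat, mul_neg, mul_one,
      pow_zero, two_mul]
    match_scalars
    ring
  | one =>
    have e : ((1 : ℕ) : ℤ) - 2 = -1 := by norm_num
    rw [e]
    simp only [Nat.cast_one, Chebyshev.C_one, sub_self, Chebyshev.S_neg_one, Chebyshev.S_zero,
      Chebyshev.S_one, map_one, map_zero, mul_zero, mul_one, aeval_X, pow_one]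
    match_scalars
    field_simp
    ring
  | more k ih1 ih2 =>
    have eC : aeval a (Chebyshev.C ℂ ((k + 2 : ℕ) : ℤ)) =
        a * aeval a (Chebyshev.C ℂ ((k + 1 : ℕ) : ℤ)) - aeval a (Chebyshev.C ℂ (k : ℤ)) := by
      push_cast
      rw [Chebyshev.C_add_two, map_sub, map_mul, aeval_X]
    set u0 := aeval a (Chebyshev.S ℂ ((k : ℤ) - 2)) with hu0
    set u1 := aeval a (Chebyshev.S ℂ ((k : ℤ) - 1)) with hu1
    have e2 : aeval a (Chebyshev.S ℂ (k : ℤ)) = a * u1 - u0 := by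
      rw [Chebyshev.S_eq, map_sub, map_mul, aeval_X]
    have e3 : aeval a (Chebyshev.S ℂ ((k : ℤ) + 1)) = a * (a * u1 - u0) - u1 := by
      rw [Chebyshev.S_add_one, map_sub, map_mul, aeval_X, e2]
    have e4 : aeval a (Chebyshev.S ℂ ((k : ℤ) + 2)) = a * (a * (a * u1 - u0) - u1)
        - (a * u1 - u0) := by
      rw [Chebyshev.S_add_two, map_sub, map_mul, aeval_X, e3, e2]
    have f1 : ((k + 1 : ℕ) : ℤ) - 1 = k := by push_cast; ring
    have f2 : ((k + 1 : ℕ) : ℤ) - 2 = k - 1 := by push_cast; ring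
    have f3 : ((k + 2 : ℕ) : ℤ) - 1 = k + 1 := by push_cast; ring
    have f4 : ((k + 2 : ℕ) : ℤ) - 2 = k := by push_cast; ring
    rw [f1, f2, e2] at ih2
    rw [f3, f4, eC, sub_mul, smul_sub, mul_assoc, ← mul_smul_comm, ih2]
    rw [e2] at ih1
    have f5 : ((k + 1 : ℕ) : ℤ) = k + 1 := by push_cast; ring
    have f6 : ((k + 2 : ℕ) : ℤ) = k + 2 := by push_cast; ring
    rw [ih1, f5, f6, e2, e3, e4, ← hu1]
    have hs := h.sq_mul hq
    have g : ∀ x, a * (a * (b * x)) = (q ^ 2 + q⁻¹ ^ 2) • (a * (b * (a * x))) - b * (a * (a * x))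
        - (q ^ 2 - q⁻¹ ^ 2) ^ 2 • (b * x) := by
      intro x
      have := congrArg (· * x) hs
      simpa only [sub_mul, smul_mul_assoc, sq, mul_assoc] using this
    simp only [mul_sub, mul_smul_comm, smul_sub, mul_assoc, g, pow_succ (q ^ 2), pow_succ (q⁻¹ ^ 2)]
    generalize (q ^ 2) ^ k = y
    generalize (q⁻¹ ^ 2) ^ k = z
    match_scalars <;> field_simp <;> ring

theorem commute_aeval_C (h : IsSkeinTriple q a b c) (hq : q ≠ 0) (hκ : q ^ 2 - q⁻¹ ^ 2 ≠ 0) {n : ℕ}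
    (hn : (q ^ 2) ^ n = 1) : Commute (aeval a (Chebyshev.C ℂ n)) b := by
  have hn' : (q⁻¹ ^ 2) ^ n = 1 := by rw [inv_pow, inv_pow, hn, inv_one]
  have key := h.aeval_C_mul hq n
  rw [hn, hn', sub_self, zero_smul] at key
  have e : aeval a (Chebyshev.C ℂ n) =
      aeval a (Chebyshev.S ℂ n) - aeval a (Chebyshev.S ℂ ((n : ℤ) - 2)) := by
    rw [← map_sub]
    congr 1
    rw [Chebyshev.C_eq_S_sub_X_mul_S, Chebyshev.S_sub_two]
    ring
  have key2 : (q ^ 2 - q⁻¹ ^ 2) • (aeval a (Chebyshev.C ℂ n) * b) =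
      (q ^ 2 - q⁻¹ ^ 2) • (b * aeval a (Chebyshev.C ℂ n)) := by
    rw [key, e, mul_sub]
    module
  exact (smul_right_injective A hκ) key2

end IsSkeinTriple

/-! ### Generation and central elements -/

theorem isSkeinTriple_curve (q : ℂ) :
    IsSkeinTriple q (curve q .zero) (curve q .infty) (curve q .one) := by
  constructor
  · simpa [curve] using RingQuot.mkAlgHom_rel ℂ (SkeinRel.rel_one (q := q))
  · simpa [curve] using RingQuot.mkAlgHom_rel ℂ (SkeinRel.rel_zero (q := q))
  · simpa [curve] using RingQuot.mkAlgHom_rel ℂ (SkeinRel.rel_infty (q := q))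

theorem peripheral_eq (q : ℂ) :
    peripheral q = peri q (curve q .zero) (curve q .infty) (curve q .one) := rfl

theorem skein_induction {q : ℂ} {P : Skein q → Prop} (hc : ∀ m, P (curve q m))
    (h1 : ∀ z : ℂ, P (algebraMap ℂ (Skein q) z)) (hadd : ∀ x y, P x → P y → P (x + y))
    (hmul : ∀ x y, P x → P y → P (x * y)) (x : Skein q) : P x := by
  obtain ⟨y, rfl⟩ := RingQuot.mkAlgHom_surjective ℂ (SkeinRel q) x
  induction y using FreeAlgebra.induction with
  | grade0 z => simpa using h1 z
  | grade1 m => exact hc m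
  | mul x y hx hy => simpa using hmul _ _ hx hy
  | add x y hx hy => simpa using hadd _ _ hx hy

theorem mem_center_of_commute {q : ℂ} {z : Skein q} (h : ∀ m, Commute (curve q m) z) :
    z ∈ Center q := by
  rw [Subalgebra.mem_center_iff]
  intro x
  induction x using skein_induction with
  | hc m => exact h m
  | h1 c => exact Algebra.commutes c z
  | hadd x y hx hy => rw [add_mul, mul_add, hx, hy]
  | hmul x y hx hy => rw [mul_assoc, hy, ← mul_assoc, hx, mul_assoc]

theorem peripheral_mem_center {q : ℂ} (hq : q ≠ 0) : peripheral q ∈ Center q := by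
  have h := isSkeinTriple_curve q
  rw [peripheral_eq]
  refine mem_center_of_commute fun m => ?_
  cases m with
  | zero => exact h.peri_commute hq
  | infty => rw [← h.peri_rotate hq]; exact h.rotate.peri_commute hq
  | one =>
    rw [← h.peri_rotate hq, ← h.rotate.peri_rotate hq]
    exact h.rotate.rotate.peri_commute hq

theorem pow_ordTwo (q : ℂ) : (q ^ 2) ^ ordTwo q = 1 := pow_orderOf_eq_one _

theorem IsSkeinTriple.commute_aeval_C' {A : Type*} [Ring A] [Algebra ℂ A] {q : ℂ} {a b c : A}
    (h : IsSkeinTriple q a b c) (hq : q ≠ 0) (hκ : q ^ 2 - q⁻¹ ^ 2 ≠ 0) {n : ℕ}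
    (hn : (q ^ 2) ^ n = 1) : Commute (aeval a (Chebyshev.C ℂ n)) c := by
  have hb := h.commute_aeval_C hq hκ hn
  have ha : Commute (aeval a (Chebyshev.C ℂ n)) a := IsSkeinTriple.commute_aeval_self _
  have : c = (q ^ 2 - q⁻¹ ^ 2)⁻¹ • (q • (a * b) - q⁻¹ • (b * a)) := by
    rw [h.ab, smul_smul, inv_mul_cancel₀ hκ, one_smul]
  rw [this]
  exact (((ha.mul_right hb).smul_right q).sub_right ((hb.mul_right ha).smul_right _)).smul_right _

theorem threadedCurve_mem_center {q : ℂ} (hq : q ≠ 0) (hκ : q ^ 2 - q⁻¹ ^ 2 ≠ 0) (m : Slope) :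
    threadedCurve q m ∈ Center q := by
  have key : ∀ {a b c : Skein q}, IsSkeinTriple q a b c →
      Commute a (aeval a (cheb (ordTwo q))) ∧ Commute b (aeval a (cheb (ordTwo q))) ∧
      Commute c (aeval a (cheb (ordTwo q))) := fun {a b c} h =>
    ⟨(IsSkeinTriple.commute_aeval_self _).symm, (h.commute_aeval_C hq hκ (pow_ordTwo q)).symm,
      (h.commute_aeval_C' hq hκ (pow_ordTwo q)).symm⟩
  have h := isSkeinTriple_curve q
  refine mem_center_of_commute fun l => ?_
  have h0 := key h
  have h1 := key h.rotate
  have h2 := key h.rotate.rotate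
  cases m <;> cases l <;> simp only [threadedCurve, h0, h1, h2]

/-! ### Type-`0` operators -/

/-- The ratio `r_i` as a function of `x = q ^ (2i) σ`. -/
def ratio (q w x : ℂ) : ℂ :=
  (w + q ^ 2 * x ^ 2 + q⁻¹ ^ 2 * x⁻¹ ^ 2) / ((x - x⁻¹) * (q ^ 2 * x - q⁻¹ ^ 2 * x⁻¹))

section operators

variable {V : Type*} [AddCommGroup V] [Module ℂ V] {n : ℕ}

/-- The operator `v_i ↦ s_i v_{i+1} + t_{i-1} v_{i-1}`. -/
def hop (v : Module.Basis (ZMod n) ℂ V) (s t : ZMod n → ℂ) : Module.End ℂ V :=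
  v.constr ℂ fun i => s i • v (i + 1) + t (i - 1) • v (i - 1)

/-- The diagonal operator `v_i ↦ (x_i + x_i⁻¹) v_i`. -/
def diagOp (v : Module.Basis (ZMod n) ℂ V) (x : ZMod n → ℂ) : Module.End ℂ V :=
  v.constr ℂ fun i => (x i + (x i)⁻¹) • v i

@[simp]
theorem hop_apply (v : Module.Basis (ZMod n) ℂ V) (s t : ZMod n → ℂ) (i : ZMod n) :
    hop v s t (v i) = s i • v (i + 1) + t (i - 1) • v (i - 1) := v.constr_basis ..

@[simp]
theorem diagOp_apply (v : Module.Basis (ZMod n) ℂ V) (x : ZMod n → ℂ) (i : ZMod n) :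
    diagOp v x (v i) = (x i + (x i)⁻¹) • v i := v.constr_basis ..

/-- The operator of the curve of slope `1`. Its link coefficients have the same products `s_i t_i` as
those of the operator `hop v s t` of the curve of slope `∞`. -/
def hopOne (q : ℂ) (v : Module.Basis (ZMod n) ℂ V) (x s t : ZMod n → ℂ) : Module.End ℂ V :=
  hop v (fun i => q * x i * s i) (fun i => q⁻¹ * (x i)⁻¹ * t i)

/-- A sequence `x_i` of the form `q ^ (2i) σ`, for which no `x_i` is `0` or `±1`.
These are the conditions under which the denominators in `ratio` do not vanish. -/
structure IsGeomSeq (q : ℂ) (x : ZMod n → ℂ) : Prop where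
  succ : ∀ i, x (i + 1) = q ^ 2 * x i
  ne_zero : ∀ i, x i ≠ 0
  sub_inv_ne_zero : ∀ i, x i - (x i)⁻¹ ≠ 0

theorem IsGeomSeq.pred {q : ℂ} {x : ZMod n → ℂ} (hx : IsGeomSeq q x) (hq : q ≠ 0) (i : ZMod n) :
    x (i - 1) = q⁻¹ ^ 2 * x i := by
  have := hx.succ (i - 1)
  rw [sub_add_cancel] at this
  rw [this]
  field_simp

/-- The recursion for the ratios, which is the diagonal part of the relation expressing `α₀` by
`α_∞` and `α₁`. -/
theorem ratio_step {q : ℂ} (w : ℂ) {x : ℂ} (hq : q ≠ 0) (hx : x ≠ 0) (h0 : x - x⁻¹ ≠ 0)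
    (h1 : q ^ 2 * x - (q ^ 2 * x)⁻¹ ≠ 0) (h2 : q⁻¹ ^ 2 * x - (q⁻¹ ^ 2 * x)⁻¹ ≠ 0) :
    (q ^ 2 * x - q⁻¹ ^ 2 * x⁻¹) * ratio q w x
      - (q⁻¹ ^ 2 * x - q ^ 2 * x⁻¹) * ratio q w (q⁻¹ ^ 2 * x)
      = (q ^ 2 - q⁻¹ ^ 2) * (x + x⁻¹) := by
  have e0 : x - x⁻¹ = (x ^ 2 - 1) / x := by field_simp
  have e1 : q ^ 2 * x - (q ^ 2 * x)⁻¹ = ((q ^ 2) ^ 2 * x ^ 2 - 1) / (q ^ 2 * x) := by field_simp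
  have e2 : q⁻¹ ^ 2 * x - (q⁻¹ ^ 2 * x)⁻¹ = (x ^ 2 - (q ^ 2) ^ 2) / (q ^ 2 * x) := by field_simp
  rw [e0] at h0
  rw [e1] at h1
  rw [e2] at h2
  have g0 : x ^ 2 - 1 ≠ 0 := fun h => h0 (by rw [h, zero_div])
  have g1 : (q ^ 2) ^ 2 * x ^ 2 - 1 ≠ 0 := fun h => h1 (by rw [h, zero_div])
  have g2 : x ^ 2 - (q ^ 2) ^ 2 ≠ 0 := fun h => h2 (by rw [h, zero_div])
  have r1 : ratio q w x = (w * q ^ 2 * x ^ 2 + q ^ 4 * x ^ 4 + 1) /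
      ((x ^ 2 - 1) * ((q ^ 2) ^ 2 * x ^ 2 - 1)) := by
    have e3 : q ^ 2 * x - q⁻¹ ^ 2 * x⁻¹ = ((q ^ 2) ^ 2 * x ^ 2 - 1) / (q ^ 2 * x) := by field_simp
    rw [ratio, e0, e3]
    field_simp
  have r2 : ratio q w (q⁻¹ ^ 2 * x) = (w * q ^ 2 * x ^ 2 + x ^ 4 + q ^ 4) /
      ((x ^ 2 - 1) * (x ^ 2 - (q ^ 2) ^ 2)) := by
    have e3 : q ^ 2 * (q⁻¹ ^ 2 * x) - q⁻¹ ^ 2 * (q⁻¹ ^ 2 * x)⁻¹ = (x ^ 2 - 1) / x := by field_simp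
    rw [ratio, e2, e3]
    field_simp
  have e4 : q ^ 2 * x - q⁻¹ ^ 2 * x⁻¹ = ((q ^ 2) ^ 2 * x ^ 2 - 1) / (q ^ 2 * x) := by field_simp
  have e5 : q⁻¹ ^ 2 * x - q ^ 2 * x⁻¹ = (x ^ 2 - (q ^ 2) ^ 2) / (q ^ 2 * x) := by field_simp
  rw [r1, r2, e4, e5]
  generalize hQ : q ^ 2 = Q at *
  have hQ0 : Q ≠ 0 := hQ ▸ pow_ne_zero 2 hq
  have hQ4 : q ^ 4 = Q ^ 2 := by rw [← hQ]; ring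
  rw [hQ4, inv_pow, hQ]
  field_simp
  ring

section triple

variable {q w : ℂ} {v : Module.Basis (ZMod n) ℂ V} {x s t : ZMod n → ℂ}

theorem isSkeinTriple_hop (hq : q ≠ 0) (hx : IsGeomSeq q x)
    (hr : ∀ i, s i * t i = ratio q w (x i)) :
    IsSkeinTriple q (diagOp v x) (hop v s t) (hopOne q v x s t) := by
  refine ⟨v.ext fun i => ?_, v.ext fun i => ?_, v.ext fun i => ?_⟩
  · have h0 := hx.ne_zero i
    simp only [hopOne, LinearMap.sub_apply, LinearMap.smul_apply, Module.End.mul_apply, hop_apply,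
      diagOp_apply, map_add, map_smul, hx.succ, hx.pred hq]
    match_scalars <;> field_simp <;> ring
  · have h0 := hx.ne_zero i
    have hi := hr i
    have hj := hx.pred hq i ▸ hr (i - 1)
    have key := ratio_step w hq h0 (hx.sub_inv_ne_zero i) (hx.succ i ▸ hx.sub_inv_ne_zero (i + 1))
      (hx.pred hq i ▸ hx.sub_inv_ne_zero (i - 1))
    rw [← hi, ← hj] at key
    simp only [hopOne, LinearMap.sub_apply, LinearMap.smul_apply, Module.End.mul_apply, hop_apply,
      diagOp_apply, map_add, map_smul, hx.succ, hx.pred hq, add_sub_cancel_right, sub_add_cancel]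
    match_scalars
    · field_simp
      ring
    · field_simp at key ⊢
      linear_combination key
    · field_simp
      ring
  · have h0 := hx.ne_zero i
    simp only [hopOne, LinearMap.sub_apply, LinearMap.smul_apply, Module.End.mul_apply, hop_apply,
      diagOp_apply, map_add, map_smul, hx.succ, hx.pred hq]
    match_scalars <;> field_simp <;> ring

theorem peri_hop (hq : q ≠ 0) (hx : IsGeomSeq q x) (hr : ∀ i, s i * t i = ratio q w (x i)) :
    peri q (diagOp v x) (hop v s t) (hopOne q v x s t) = w • 1 := by
  refine v.ext fun i => ?_
  have h0 := hx.ne_zero i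
  have hi := hr i
  have hj := hx.pred hq i ▸ hr (i - 1)
  have key := ratio_step w hq h0 (hx.sub_inv_ne_zero i) (hx.succ i ▸ hx.sub_inv_ne_zero (i + 1))
    (hx.pred hq i ▸ hx.sub_inv_ne_zero (i - 1))
  rw [← hi, ← hj] at key
  simp only [peri, hopOne, LinearMap.sub_apply, LinearMap.add_apply, LinearMap.smul_apply,
    Module.End.mul_apply, hop_apply, Module.End.one_apply, Module.algebraMap_end_apply,
    sq (hop _ _ _), sq (diagOp _ _), diagOp_apply, map_add, map_smul, hx.succ, hx.pred hq, add_sub_cancel_right, sub_add_cancel]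
  match_scalars
  · field_simp
    ring
  -- here the definition of the ratio enters, not only the recursion, which is independent of `w`
  · have key2 : s i * t i * ((x i - (x i)⁻¹) * (q ^ 2 * x i - q⁻¹ ^ 2 * (x i)⁻¹)) =
        w + q ^ 2 * x i ^ 2 + q⁻¹ ^ 2 * (x i)⁻¹ ^ 2 := by
      rw [hi, ratio, div_mul_cancel₀]
      refine mul_ne_zero (hx.sub_inv_ne_zero i) ?_
      have := hx.sub_inv_ne_zero (i + 1)
      rwa [hx.succ, mul_inv, ← inv_pow] at this
    field_simp at key key2 ⊢
    linear_combination key + key2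
  · field_simp
    ring

end triple

end operators

/-! ### Roots of unity and the weights -/

theorem ne_zero_of_isOfFinOrder {q : ℂ} (hq : IsOfFinOrder q) : q ≠ 0 := by
  rintro rfl
  obtain ⟨k, hk, h⟩ := isOfFinOrder_iff_pow_eq_one.1 hq
  simp [hk.ne'] at h

theorem sq_sub_inv_sq_ne_zero {q : ℂ} (hq : q ≠ 0) (hq4 : q ^ 4 ≠ 1) : q ^ 2 - q⁻¹ ^ 2 ≠ 0 := by
  intro h
  apply hq4
  field_simp at h
  linear_combination h

theorem ordTwo_pos {q : ℂ} (hq : IsOfFinOrder q) : 0 < ordTwo q := hq.pow.orderOf_pos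

/-- The sequence `x_i = q ^ (2i) σ`, indexed by `ℤ/D`, on which it is well defined since
`q ^ (2D) = 1`. -/
def weight (q σ : ℂ) (i : ZMod (ordTwo q)) : ℂ := q ^ (2 * (i.val : ℤ)) * σ

theorem weight_intCast {q : ℂ} (hq : q ≠ 0) [NeZero (ordTwo q)] (σ : ℂ) (k : ℤ) :
    weight q σ (k : ZMod (ordTwo q)) = q ^ (2 * k) * σ := by
  rw [weight, ZMod.val_intCast]
  congr 1
  conv_rhs => rw [← Int.emod_add_mul_ediv k (ordTwo q)]
  rw [mul_add, zpow_add₀ hq]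
  have : q ^ (2 * ((ordTwo q : ℤ) * (k / ordTwo q))) = 1 := by
    rw [← mul_assoc, zpow_mul, zpow_mul]
    have h := pow_ordTwo q
    rw [show q ^ (2 : ℤ) = q ^ 2 from zpow_ofNat q 2, zpow_natCast, h, one_zpow]
  rw [this, mul_one]

theorem weight_eq (q σ : ℂ) (i : ZMod (ordTwo q)) : weight q σ i = (q ^ 2) ^ i.val * σ := by
  rw [weight, zpow_mul, zpow_natCast, show q ^ (2 : ℤ) = q ^ 2 from zpow_ofNat q 2]

theorem weight_ne_zero {q σ : ℂ} (hq : q ≠ 0) (hσ : σ ≠ 0) (i : ZMod (ordTwo q)) :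
    weight q σ i ≠ 0 :=
  mul_ne_zero (zpow_ne_zero _ hq) hσ

theorem weight_pow {q σ : ℂ} (i : ZMod (ordTwo q)) : weight q σ i ^ ordTwo q = σ ^ ordTwo q := by
  rw [weight_eq, mul_pow, ← pow_mul, mul_comm i.val, pow_mul, pow_ordTwo, one_pow, one_mul]

theorem weight_zero (q σ : ℂ) : weight q σ 0 = σ := by simp [weight]

section weights

variable {q : ℂ} [NeZero (ordTwo q)] {σ : ℂ}

theorem weight_succ (hq : q ≠ 0) (i : ZMod (ordTwo q)) :
    weight q σ (i + 1) = q ^ 2 * weight q σ i := by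
  obtain ⟨k, rfl⟩ := ZMod.intCast_surjective i
  rw [show (k : ZMod (ordTwo q)) + 1 = ((k + 1 : ℤ) : ZMod (ordTwo q)) by push_cast; rfl,
    weight_intCast hq, weight_intCast hq, mul_add, zpow_add₀ hq, mul_one,
    show q ^ (2 : ℤ) = q ^ 2 from zpow_ofNat q 2]
  ring

/-- If `x_i = ±1`, then `z₀ = x_i ^ D + x_i ^ (-D)` is `2`, or it is `-2` and `D` is odd, so that
`z₀` is not general. -/
theorem isGeomSeq_weight (hq : q ≠ 0) (hσ : σ ≠ 0) (hg : IsGeneral q (zZero q σ)) :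
    IsGeomSeq q (weight q σ) := by
  refine ⟨weight_succ hq, weight_ne_zero hq hσ, fun i h => ?_⟩
  have hx := weight_ne_zero hq hσ i
  have hp := weight_pow (q := q) (σ := σ) i
  have h2 : weight q σ i ^ 2 = 1 := by
    field_simp at h
    linear_combination h
  have hz : zZero q σ = weight q σ i ^ ordTwo q + (weight q σ i ^ ordTwo q)⁻¹ := by
    rw [hp, zZero, inv_pow]
  rcases (sq_eq_sq_iff_eq_or_eq_neg.1 (h2.trans (one_pow 2).symm)) with h1 | h1
  · rw [h1, one_pow, inv_one] at hz
    rcases hg with hg | hg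
    · exact hg.1 (by rw [hz]; norm_num)
    · have := hg.1
      rw [hz] at this
      norm_num at this
  · rw [h1] at hz
    rcases Nat.even_or_odd (ordTwo q) with he | ho
    · rw [he.neg_one_pow, inv_one] at hz
      rcases hg with hg | hg
      · exact hg.1 (by rw [hz]; norm_num)
      · have := hg.1
        rw [hz] at this
        norm_num at this
    · rw [ho.neg_one_pow] at hz
      rcases hg with hg | hg
      · exact hg.2 (by rw [hz]; norm_num)
      · exact (Nat.not_even_iff_odd.2 ho) hg.2

variable {V : Type*} [AddCommGroup V] [Module ℂ V] {v : Module.Basis (ZMod (ordTwo q)) ℂ V}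
  {w : ℂ} {s t : ZMod (ordTwo q) → ℂ} {ρ : Skein q →ₐ[ℂ] Module.End ℂ V}

theorem rCoeff_eq_ratio (hq : q ≠ 0) (k : ℤ) :
    rCoeff q σ w k = ratio q w (weight q σ k) := by
  have h2 : q ^ (2 : ℤ) = q ^ 2 := zpow_ofNat q 2
  rw [weight_intCast hq, rCoeff, ratio, lamHat, lamHat]
  have e1 : q ^ (-2 * k) = (q ^ (2 * k))⁻¹ := by rw [← zpow_neg]; congr 1; ring
  have e2 : q ^ (2 * (k + 1)) = q ^ 2 * q ^ (2 * k) := by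
    rw [← h2, ← zpow_add₀ hq]; congr 1; ring
  have e3 : q ^ (-2 * (k + 1)) = q⁻¹ ^ 2 * (q ^ (2 * k))⁻¹ := by
    rw [inv_pow, ← h2, ← zpow_neg, ← zpow_neg, ← zpow_add₀ hq]; congr 1; ring
  have e4 : q ^ (4 * k + 2) = q ^ 2 * (q ^ (2 * k)) ^ 2 := by
    rw [← h2, sq, ← zpow_add₀ hq, ← zpow_add₀ hq]; congr 1; ring
  have e5 : q ^ (-4 * k - 2) = q⁻¹ ^ 2 * (q ^ (2 * k))⁻¹ ^ 2 := by
    rw [inv_pow, ← h2, sq, ← zpow_neg, ← zpow_neg, ← zpow_add₀ hq, ← zpow_add₀ hq]; congr 1; ring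
  rw [e1, e2, e3, e4, e5, mul_inv]
  ring

/-- Type-`0` representations in terms of operators indexed by `ℤ/D`. -/
theorem isTypeZero_iff (hq : q ≠ 0) : IsTypeZero q v σ w s t ρ ↔
    σ ≠ 0 ∧ IsGeneral q (zZero q σ) ∧ (∀ i, s i * t i = ratio q w (weight q σ i)) ∧
      ρ (curve q .zero) = diagOp v (weight q σ) ∧ ρ (curve q .infty) = hop v s t ∧
      ρ (curve q .one) = hopOne q v (weight q σ) s t := by
  have hpar : (s, t) ∈ paramSet q σ w ↔ ∀ i, s i * t i = ratio q w (weight q σ i) := by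
    rw [paramSet, Set.mem_ofPred_eq]
    constructor
    · intro h i
      obtain ⟨k, rfl⟩ := ZMod.intCast_surjective i
      rw [h k, rCoeff_eq_ratio hq]
    · intro h k
      rw [rCoeff_eq_ratio hq]
      exact h k
  have hc : ∀ {f g : Module.End ℂ V}, f = g ↔ ∀ k : ℤ, f (v k) = g (v k) := by
    intro f g
    refine ⟨fun h k => by rw [h], fun h => v.ext fun i => ?_⟩
    obtain ⟨k, rfl⟩ := ZMod.intCast_surjective i
    exact h k
  have e1 : ∀ k : ℤ, q ^ (-2 * k) = (q ^ (2 * k))⁻¹ := fun k => by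
    rw [← zpow_neg]; congr 1; ring
  have h0 : ∀ k : ℤ, lam q σ k = weight q σ k + (weight q σ k)⁻¹ := by
    intro k
    rw [weight_intCast hq, lam, e1, mul_inv]
  have h1 : ∀ k : ℤ, q ^ (2 * k + 1) * σ * s k = q * weight q σ k * s k := by
    intro k
    rw [weight_intCast hq, zpow_add₀ hq, zpow_one]
    ring
  have h2 : ∀ k : ℤ, q ^ (-2 * k + 1) * σ⁻¹ * t (k - 1) =
      q⁻¹ * (weight q σ (k - 1))⁻¹ * t (k - 1) := by
    intro k
    have hw := weight_succ (σ := σ) hq ((k : ZMod (ordTwo q)) - 1)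
    rw [sub_add_cancel, weight_intCast hq] at hw
    have : weight q σ ((k : ZMod (ordTwo q)) - 1) = q⁻¹ ^ 2 * (q ^ (2 * k) * σ) := by
      rw [hw]; field_simp
    rw [this, zpow_add₀ hq, zpow_one, e1, mul_inv, mul_inv]
    field_simp
  rw [hc, hc, hc]
  constructor
  · rintro ⟨a1, a2, a3, a4, a5, a6⟩
    refine ⟨a1, a2, hpar.1 a3, fun k => ?_, fun k => ?_, fun k => ?_⟩
    · rw [a4, h0, diagOp_apply]
    · rw [a6, hop_apply]
    · rw [a5, hopOne, hop_apply, h1, h2]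
  · rintro ⟨a1, a2, a3, a4, a5, a6⟩
    refine ⟨a1, a2, hpar.2 a3, fun k => ?_, fun k => ?_, fun k => ?_⟩
    · rw [a4, h0, diagOp_apply]
    · rw [a6, hopOne, hop_apply, h1, h2]
    · rw [a5, hop_apply]

end weights

/-! ### Constructing representations -/

/-- The value of a triple at a slope. -/
def slopeFun {A : Type*} (a b c : A) : Slope → A
  | .zero => a
  | .one => c
  | .infty => b

/-- The homomorphism out of the skein algebra given by a triple satisfying its relations. -/
def IsSkeinTriple.lift {A : Type*} [Ring A] [Algebra ℂ A] {q : ℂ} {a b c : A}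
    (h : IsSkeinTriple q a b c) : Skein q →ₐ[ℂ] A :=
  RingQuot.liftAlgHom ℂ ⟨FreeAlgebra.lift ℂ (slopeFun a b c), by
    intro x y hxy
    cases hxy with
    | rel_one => simpa [slopeFun] using h.ab
    | rel_infty => simpa [slopeFun] using h.ca
    | rel_zero => simpa [slopeFun] using h.bc⟩

theorem IsSkeinTriple.lift_curve {A : Type*} [Ring A] [Algebra ℂ A] {q : ℂ} {a b c : A}
    (h : IsSkeinTriple q a b c) (m : Slope) : h.lift (curve q m) = slopeFun a b c m := by
  simp [lift, curve]

theorem exists_isTypeZero {q : ℂ} (hq : q ≠ 0) [NeZero (ordTwo q)] {V : Type*} [AddCommGroup V]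
    [Module ℂ V] (v : Module.Basis (ZMod (ordTwo q)) ℂ V) {σ w : ℂ}
    {s t : ZMod (ordTwo q) → ℂ} (hσ : σ ≠ 0) (hg : IsGeneral q (zZero q σ))
    (hr : ∀ i, s i * t i = ratio q w (weight q σ i)) :
    ∃ ρ : Skein q →ₐ[ℂ] Module.End ℂ V, IsTypeZero q v σ w s t ρ := by
  have h := isSkeinTriple_hop (v := v) hq (isGeomSeq_weight hq hσ hg) hr
  exact ⟨h.lift, (isTypeZero_iff hq).2 ⟨hσ, hg, hr, h.lift_curve .zero, h.lift_curve .infty,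
    h.lift_curve .one⟩⟩

theorem map_threadedCurve {A : Type*} [Ring A] [Algebra ℂ A] {q : ℂ} (f : Skein q →ₐ[ℂ] A)
    (m : Slope) : f (threadedCurve q m) = aeval (f (curve q m)) (cheb (ordTwo q)) := by
  rw [threadedCurve, Polynomial.aeval_algHom_apply]

/-- The defining property of `T_k`. -/
theorem eval_cheb {x : ℂ} (hx : x ≠ 0) (k : ℕ) :
    (cheb k).eval (x + x⁻¹) = x ^ k + x⁻¹ ^ k := by
  rw [cheb]
  induction k using Nat.twoStepInduction with
  | zero => norm_num
  | one => simp
  | more k h1 h2 =>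
    rw [show ((k + 2 : ℕ) : ℤ) = (k : ℤ) + 2 by push_cast; rfl, Chebyshev.C_add_two, eval_sub,
      eval_mul, eval_X, h1]
    rw [show ((k + 1 : ℕ) : ℤ) = (k : ℤ) + 1 by push_cast; rfl] at h2
    rw [h2]
    simp only [inv_pow]
    field_simp
    ring

theorem exists_add_inv_eq (z : ℂ) : ∃ x : ℂ, x ≠ 0 ∧ x + x⁻¹ = z := by
  obtain ⟨x, hx⟩ := IsAlgClosed.exists_root (X ^ 2 - C z * X + 1 : ℂ[X]) (by
    have : (X ^ 2 - C z * X + 1 : ℂ[X]).degree = 2 := by compute_degree!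
    rw [this]; norm_num)
  simp only [IsRoot.def, eval_add, eval_sub, eval_pow, eval_X, eval_mul, eval_C, eval_one] at hx
  have h0 : x ≠ 0 := by
    rintro rfl
    simp at hx
  refine ⟨x, h0, ?_⟩
  field_simp
  linear_combination hx

theorem IsTypeZero.apply_threadedCurve_zero {q : ℂ} (hq : q ≠ 0) [NeZero (ordTwo q)] {V : Type*}
    [AddCommGroup V] [Module ℂ V] {v : Module.Basis (ZMod (ordTwo q)) ℂ V} {σ w : ℂ}
    {s t : ZMod (ordTwo q) → ℂ} {ρ : Skein q →ₐ[ℂ] Module.End ℂ V}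
    (h : IsTypeZero q v σ w s t ρ) :
    ρ (threadedCurve q .zero) = zZero q σ • (1 : Module.End ℂ V) := by
  obtain ⟨hσ, hg, hr, h0, -, -⟩ := (isTypeZero_iff hq).1 h
  rw [map_threadedCurve, h0]
  refine v.ext fun i => ?_
  rw [Module.End.aeval_apply_of_hasEigenvector (μ := weight q σ i + (weight q σ i)⁻¹)
    ⟨Module.End.mem_eigenspace_iff.2 (diagOp_apply ..), v.ne_zero i⟩,
    eval_cheb (weight_ne_zero hq hσ i), inv_pow, weight_pow, zZero, inv_pow]
  rfl

theorem IsTypeZero.apply_peripheral {q : ℂ} (hq : q ≠ 0) [NeZero (ordTwo q)] {V : Type*}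
    [AddCommGroup V] [Module ℂ V] {v : Module.Basis (ZMod (ordTwo q)) ℂ V} {σ w : ℂ}
    {s t : ZMod (ordTwo q) → ℂ} {ρ : Skein q →ₐ[ℂ] Module.End ℂ V}
    (h : IsTypeZero q v σ w s t ρ) : ρ (peripheral q) = w • (1 : Module.End ℂ V) := by
  obtain ⟨hσ, hg, hr, h0, h1, h2⟩ := (isTypeZero_iff hq).1 h
  rw [← peri_hop (v := v) hq (isGeomSeq_weight hq hσ hg) hr, peripheral, peri, ← h0, ← h1, ← h2]
  simp

/-! ### Central elements act as scalars -/

theorem eventually_eval_ne_zero {p : ℂ[X]} (hp : p ≠ 0) (x₀ : ℂ) :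
    ∀ᶠ x in 𝓝[≠] x₀, p.eval x ≠ 0 :=
  nhdsNE_le_cofinite x₀ (Polynomial.finite_setOfPred_isRoot hp).eventually_cofinite_notMem

/-- A factorization `r x₀ = s t` of a value of a continuous function extends to a factorization
of the function into factors that are continuous at `x₀`. -/
theorem exists_continuousAt_factors {r : ℂ → ℂ} {x₀ s t : ℂ} (hr : ContinuousAt r x₀)
    (hst : s * t = r x₀) : ∃ S T : ℂ → ℂ, ContinuousAt S x₀ ∧ ContinuousAt T x₀ ∧ S x₀ = s ∧
      T x₀ = t ∧ ∀ x, S x * T x = r x := by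
  by_cases hs : s = 0
  · by_cases ht : t = 0
    · have hsq : ∀ x, ∃ y : ℂ, y * y = r x := fun x => by
        obtain ⟨y, hy⟩ := IsAlgClosed.exists_pow_nat_eq (r x) (n := 2) (by norm_num)
        exact ⟨y, by rw [← hy, sq]⟩
      choose y hy using hsq
      have h0 : r x₀ = 0 := by rw [← hst, hs, zero_mul]
      have hy0 : y x₀ = 0 := mul_self_eq_zero.1 ((hy x₀).trans h0)
      -- a square root of a continuous function is continuous at the zeros of the function
      have hc : ContinuousAt y x₀ := by
        rw [ContinuousAt, hy0, tendsto_zero_iff_norm_tendsto_zero]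
        have h1 : (fun x => ‖y x‖) = fun x => Real.sqrt ‖r x‖ := by
          funext x
          rw [← hy x, norm_mul, Real.sqrt_mul_self (norm_nonneg _)]
        rw [h1]
        have h2 : ContinuousAt (fun x => Real.sqrt ‖r x‖) x₀ := hr.norm.sqrt
        simpa [ContinuousAt, h0] using h2
      exact ⟨y, y, hc, hc, by rw [hy0, hs], by rw [hy0, ht], hy⟩
    · exact ⟨fun x => r x / t, fun _ => t, hr.div_const t, continuousAt_const,
        by simp only [← hst]; field_simp, rfl, fun x => by field_simp⟩
  · exact ⟨fun _ => s, fun x => r x / s, continuousAt_const, hr.div_const s, rfl,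
      by simp only [← hst]; field_simp, fun x => by field_simp⟩

theorem continuousAt_freeAlgebra_lift {X ι A : Type*} [TopologicalSpace X] [Ring A] [Algebra ℂ A]
    [TopologicalSpace A] [IsTopologicalRing A] {G : X → ι → A} {x₀ : X}
    (hG : ∀ i, ContinuousAt (fun x => G x i) x₀) (y : FreeAlgebra ℂ ι) :
    ContinuousAt (fun x => FreeAlgebra.lift ℂ (G x) y) x₀ := by
  induction y using FreeAlgebra.induction with
  | grade0 c => simpa using continuousAt_const
  | grade1 i => simpa using hG i
  | mul y z hy hz => simp only [map_mul]; exact hy.mul hz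
  | add y z hy hz => simp only [map_add]; exact hy.add hz

section generic

variable {V : Type*} [AddCommGroup V] [Module ℂ V] {n : ℕ} {v : Module.Basis (ZMod n) ℂ V}
  {q : ℂ} {x s t : ZMod n → ℂ}

theorem repr_diagOp (y : V) (j : ZMod n) :
    v.repr (diagOp v x y) j = (x j + (x j)⁻¹) * v.repr y j := by
  have : (Finsupp.lapply j ∘ₗ v.repr.toLinearMap) ∘ₗ diagOp v x =
      (x j + (x j)⁻¹) • (Finsupp.lapply j ∘ₗ v.repr.toLinearMap) := by
    refine v.ext fun i => ?_
    by_cases h : i = j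
    · subst h; simp
    · simp [h]
  exact LinearMap.congr_fun this y

/-- A combination of the operators of slopes `1` and `∞` moves `v_i` to `v_{i+1}` only. -/
theorem hopOne_sub_hop (hq : q ≠ 0) (hx : IsGeomSeq q x) (i : ZMod n) :
    (hopOne q v x s t - (q * (x i)⁻¹) • hop v s t) (v i) =
      (q * (x i - (x i)⁻¹) * s i) • v (i + 1) := by
  have := hx.ne_zero i
  simp only [hopOne, LinearMap.sub_apply, LinearMap.smul_apply, hop_apply, hx.pred hq]
  match_scalars
  · ring
  · field_simp
    ring

/-- If the eigenvalues of the diagonal operator are distinct and no link `s_i` is broken, then only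
scalars commute with the three operators. -/
theorem exists_eq_smul_one_of_commute [NeZero n] (hq : q ≠ 0) (hx : IsGeomSeq q x)
    (hinj : Function.Injective fun i => x i + (x i)⁻¹) (hs : ∀ i, s i ≠ 0) {f : Module.End ℂ V}
    (h0 : Commute f (diagOp v x)) (h1 : Commute f (hop v s t))
    (h2 : Commute f (hopOne q v x s t)) : ∃ c : ℂ, f = c • (1 : Module.End ℂ V) := by
  have hdiag : ∀ i, f (v i) = v.repr (f (v i)) i • v i := by
    intro i
    apply v.repr.injective
    ext j
    by_cases hij : i = j
    · subst hij; simp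
    · have := congrArg (fun y => v.repr y j) (LinearMap.congr_fun h0.eq (v i))
      simp only [Module.End.mul_apply, repr_diagOp, diagOp_apply, map_smul, Finsupp.smul_apply,
        smul_eq_mul] at this
      have hne : (x i + (x i)⁻¹) - (x j + (x j)⁻¹) ≠ 0 :=
        sub_ne_zero.2 fun h => hij (hinj h)
      have h3 : v.repr (f (v i)) j = 0 :=
        (mul_eq_zero.1 (by linear_combination this :
          ((x i + (x i)⁻¹) - (x j + (x j)⁻¹)) * v.repr (f (v i)) j = 0)).resolve_left hne
      simp [h3, hij]
  have hstep : ∀ i, v.repr (f (v (i + 1))) (i + 1) = v.repr (f (v i)) i := by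
    intro i
    have hc : Commute f (hopOne q v x s t - (q * (x i)⁻¹) • hop v s t) :=
      h2.sub_right (h1.smul_right _)
    have := LinearMap.congr_fun hc.eq (v i)
    rw [Module.End.mul_apply, Module.End.mul_apply, hopOne_sub_hop hq hx, map_smul, hdiag i,
      map_smul, hopOne_sub_hop hq hx] at this
    have h4 := congrArg (fun y => v.repr y (i + 1)) this
    simp only [map_smul, Finsupp.smul_apply, smul_eq_mul, v.repr_self, Finsupp.single_eq_same]
      at h4
    have h5 : q * (x i - (x i)⁻¹) * s i ≠ 0 :=
      mul_ne_zero (mul_ne_zero hq (hx.sub_inv_ne_zero i)) (hs i)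
    apply mul_left_cancel₀ h5
    linear_combination h4
  refine ⟨v.repr (f (v 0)) 0, v.ext fun i => ?_⟩
  have hall : ∀ k : ℕ, v.repr (f (v (k : ZMod n))) (k : ZMod n) = v.repr (f (v 0)) 0 := by
    intro k
    induction k with
    | zero => simp
    | succ k ih => rw [Nat.cast_succ, hstep, ih]
  have hi := hall i.val
  rw [ZMod.natCast_zmod_val] at hi
  rw [hdiag i, hi]
  rfl

end generic

theorem sq_eq_one_of_not_isGeneral {y : ℂ} (hy : y ≠ 0) (h : y + y⁻¹ = 2 ∨ y + y⁻¹ = -2) :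
    y ^ 2 = 1 := by
  rcases h with h | h
  · field_simp at h
    have : (y - 1) ^ 2 = 0 := by linear_combination h
    have : y = 1 := by linear_combination pow_eq_zero_iff (two_ne_zero) |>.1 this
    rw [this, one_pow]
  · field_simp at h
    have : (y + 1) ^ 2 = 0 := by linear_combination h
    have : y = -1 := by linear_combination pow_eq_zero_iff (two_ne_zero) |>.1 this
    rw [this]; norm_num

theorem isGeneral_of_sq_ne_one {q σ : ℂ} (hσ : σ ≠ 0) (h : (σ ^ ordTwo q) ^ 2 ≠ 1) :
    IsGeneral q (zZero q σ) := by
  rw [zZero, inv_pow]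
  exact Or.inl ⟨fun h' => h (sq_eq_one_of_not_isGeneral (pow_ne_zero _ hσ) (Or.inl h')),
    fun h' => h (sq_eq_one_of_not_isGeneral (pow_ne_zero _ hσ) (Or.inr h'))⟩

theorem continuousAt_weight {q : ℂ} (i : ZMod (ordTwo q)) (σ₀ : ℂ) :
    ContinuousAt (fun σ => weight q σ i) σ₀ :=
  continuousAt_const.mul continuousAt_id

section deformation

variable {q : ℂ} [NeZero (ordTwo q)] {V : Type*} [AddCommGroup V] [Module ℂ V]
  {v : Module.Basis (ZMod (ordTwo q)) ℂ V} {σ w : ℂ} {s t : ZMod (ordTwo q) → ℂ}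
  {ρ : Skein q →ₐ[ℂ] Module.End ℂ V}

/-- For generic `σ` the operator of slope `0` has distinct eigenvalues. -/
theorem injective_weight_add_inv (hq : q ≠ 0) (hσ : σ ≠ 0) (h : (σ ^ ordTwo q) ^ 2 ≠ 1) :
    Function.Injective fun i => weight q σ i + (weight q σ i)⁻¹ := by
  intro i j hij
  have hi := weight_ne_zero hq hσ i
  have hj := weight_ne_zero hq hσ j
  simp only at hij
  have h1 : (weight q σ i - weight q σ j) * (weight q σ i * weight q σ j - 1) = 0 := by
    field_simp at hij
    linear_combination hij
  rcases mul_eq_zero.1 h1 with h2 | h2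
  · rw [weight_eq, weight_eq, ← sub_mul] at h2
    have h3 := sub_eq_zero.1 ((mul_eq_zero.1 h2).resolve_right hσ)
    exact ZMod.val_injective _ (pow_injOn_Iio_orderOf (ZMod.val_lt i) (ZMod.val_lt j) h3)
  · exfalso
    apply h
    calc (σ ^ ordTwo q) ^ 2 = (weight q σ i * weight q σ j) ^ ordTwo q := by
          rw [mul_pow, weight_pow, weight_pow, sq]
      _ = 1 := by rw [sub_eq_zero.1 h2, one_pow]

theorem IsTypeZero.exists_eq_smul_one_of_generic (hq : q ≠ 0) (h : IsTypeZero q v σ w s t ρ)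
    (hσ2 : (σ ^ ordTwo q) ^ 2 ≠ 1) (hw : ∀ i, ratio q w (weight q σ i) ≠ 0) {z : Skein q}
    (hz : z ∈ Center q) : ∃ c : ℂ, ρ z = c • (1 : Module.End ℂ V) := by
  obtain ⟨hσ, hg, hr, h0, h1, h2⟩ := (isTypeZero_iff hq).1 h
  have hcomm : ∀ m, Commute (ρ z) (ρ (curve q m)) := fun m => by
    rw [commute_iff_eq, ← map_mul, ← map_mul, Subalgebra.mem_center_iff.1 hz]
  refine exists_eq_smul_one_of_commute (s := s) (t := t) hq (isGeomSeq_weight hq hσ hg)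
    (injective_weight_add_inv hq hσ hσ2) (fun i hi => hw i ?_) (h0 ▸ hcomm .zero)
    (h1 ▸ hcomm .infty) (h2 ▸ hcomm .one)
  rw [← hr, hi, zero_mul]

theorem eventually_generic (hq : q ≠ 0) (w σ₀ : ℂ) : ∀ᶠ σ in 𝓝[≠] σ₀, σ ≠ 0 ∧
    (σ ^ ordTwo q) ^ 2 ≠ 1 ∧ ∀ i, ratio q w (weight q σ i) ≠ 0 := by
  have e0 : ∀ᶠ σ in 𝓝[≠] σ₀, σ ≠ 0 := by
    simpa using eventually_eval_ne_zero (X_ne_zero (R := ℂ)) σ₀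
  have e1 : ∀ᶠ σ in 𝓝[≠] σ₀, (σ ^ ordTwo q) ^ 2 ≠ 1 := by
    have hp : (X ^ (ordTwo q * 2) - C 1 : ℂ[X]) ≠ 0 :=
      X_pow_sub_C_ne_zero (Nat.mul_pos (NeZero.pos _) two_pos) 1
    filter_upwards [eventually_eval_ne_zero hp σ₀] with σ hσ h
    apply hσ
    rw [eval_sub, eval_pow, eval_X, eval_C, pow_mul, h, sub_self]
  -- this is `(q x_i)²` times the numerator of `r_i`
  have e2 : ∀ᶠ σ in 𝓝[≠] σ₀, ∀ i,
      w * q ^ 2 * weight q σ i ^ 2 + q ^ 4 * weight q σ i ^ 4 + 1 ≠ 0 := by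
    rw [eventually_all]
    intro i
    have hp : (C (w * q ^ 2 * weight q 1 i ^ 2) * X ^ 2 + C (q ^ 4 * weight q 1 i ^ 4) * X ^ 4 + 1
        : ℂ[X]) ≠ 0 := by
      intro h
      have := congrArg (eval 0) h
      simp at this
    filter_upwards [eventually_eval_ne_zero hp σ₀] with σ hσ h
    apply hσ
    simp only [eval_add, eval_mul, eval_C, eval_pow, eval_X, eval_one]
    rw [weight_eq] at h ⊢
    linear_combination h
  filter_upwards [e0, e1, e2] with σ h0 h1 h2
  refine ⟨h0, h1, fun i => ?_⟩
  have hx := isGeomSeq_weight hq h0 (isGeneral_of_sq_ne_one h0 h1)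
  have hi := weight_ne_zero hq h0 i
  have hd := hx.sub_inv_ne_zero (i + 1)
  rw [hx.succ, mul_inv, ← inv_pow] at hd
  refine div_ne_zero (fun h => h2 i ?_) (mul_ne_zero (hx.sub_inv_ne_zero i) hd)
  field_simp at h
  linear_combination h

theorem continuousAt_ratio (hq : q ≠ 0) (hσ : σ ≠ 0) (hg : IsGeneral q (zZero q σ)) (w : ℂ)
    (i : ZMod (ordTwo q)) : ContinuousAt (fun σ => ratio q w (weight q σ i)) σ := by
  have hx := isGeomSeq_weight hq hσ hg
  have hd := hx.sub_inv_ne_zero (i + 1)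
  rw [hx.succ, mul_inv, ← inv_pow] at hd
  have hc := continuousAt_weight i σ
  have hc' := hc.inv₀ (hx.ne_zero i)
  exact ((continuousAt_const.add (continuousAt_const.mul (hc.pow 2))).add
    (continuousAt_const.mul (hc'.pow 2))).div
    ((hc.sub hc').mul ((continuousAt_const.mul hc).sub (continuousAt_const.mul hc')))
    (mul_ne_zero (hx.sub_inv_ne_zero i) hd)

theorem continuousAt_toMatrix_hop {S T : ℂ → ZMod (ordTwo q) → ℂ}
    (hS : ∀ i, ContinuousAt (fun σ => S σ i) σ) (hT : ∀ i, ContinuousAt (fun σ => T σ i) σ) :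
    ContinuousAt (fun σ => LinearMap.toMatrixAlgEquiv v (hop v (S σ) (T σ))) σ := by
  refine continuousAt_pi.2 fun i => continuousAt_pi.2 fun j => ?_
  simp only [LinearMap.toMatrixAlgEquiv_apply, hop_apply, map_add, map_smul, Finsupp.add_apply,
    Finsupp.smul_apply, smul_eq_mul]
  exact ((hS _).mul continuousAt_const).add ((hT _).mul continuousAt_const)

theorem continuousAt_toMatrix_diagOp (hσ : σ ≠ 0) (hq : q ≠ 0) :
    ContinuousAt (fun σ => LinearMap.toMatrixAlgEquiv v (diagOp v (weight q σ))) σ := by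
  refine continuousAt_pi.2 fun i => continuousAt_pi.2 fun j => ?_
  simp only [LinearMap.toMatrixAlgEquiv_apply, diagOp_apply, map_smul, Finsupp.smul_apply,
    smul_eq_mul]
  exact ((continuousAt_weight _ _).add
    ((continuousAt_weight _ _).inv₀ (weight_ne_zero hq hσ _))).mul continuousAt_const

/-- Central elements act as scalars in every type-`0` representation. The representation is a limit
of type-`0` representations with the same `w` and generic `σ`, which have this property because
only scalars commute with all operators. -/
theorem IsTypeZero.exists_eq_smul_one (hq : q ≠ 0) (h : IsTypeZero q v σ w s t ρ) {z : Skein q}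
    (hz : z ∈ Center q) : ∃ c : ℂ, ρ z = c • (1 : Module.End ℂ V) := by
  obtain ⟨hσ, hg, hr, h0, h1, h2⟩ := (isTypeZero_iff hq).1 h
  choose S T hS hT hSσ hTσ hST using fun i =>
    exists_continuousAt_factors (continuousAt_ratio hq hσ hg w i) (hr i)
  obtain ⟨y, rfl⟩ := RingQuot.mkAlgHom_surjective ℂ (SkeinRel q) z
  let G : ℂ → Slope → Matrix (ZMod (ordTwo q)) (ZMod (ordTwo q)) ℂ := fun σ' m =>
    LinearMap.toMatrixAlgEquiv v (slopeFun (diagOp v (weight q σ'))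
      (hop v (fun i => S i σ') (fun i => T i σ'))
      (hopOne q v (weight q σ') (fun i => S i σ') (fun i => T i σ')) m)
  have hG : ∀ m, ContinuousAt (fun σ' => G σ' m) σ := by
    intro m
    cases m with
    | zero => exact continuousAt_toMatrix_diagOp hσ hq
    | infty =>
      exact continuousAt_toMatrix_hop (S := fun σ' i => S i σ') (T := fun σ' i => T i σ') hS hT
    | one =>
      exact continuousAt_toMatrix_hop (S := fun σ' i => q * weight q σ' i * S i σ')
        (T := fun σ' i => q⁻¹ * (weight q σ' i)⁻¹ * T i σ')
        (fun i => (continuousAt_const.mul (continuousAt_weight i σ)).mul (hS i))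
        (fun i => (continuousAt_const.mul ((continuousAt_weight i σ).inv₀
          (weight_ne_zero hq hσ i))).mul (hT i))
  have hF := continuousAt_freeAlgebra_lift hG y
  -- the deformed matrices compute the deformed representations
  have hrep : ∀ σ' (s' t' : ZMod (ordTwo q) → ℂ) (ρ' : Skein q →ₐ[ℂ] Module.End ℂ V),
      IsTypeZero q v σ' w s' t' ρ' → s' = (fun i => S i σ') → t' = (fun i => T i σ') →
      LinearMap.toMatrixAlgEquiv v (ρ' (RingQuot.mkAlgHom ℂ (SkeinRel q) y)) =
        FreeAlgebra.lift ℂ (G σ') y := by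
    rintro σ' _ _ ρ' h' rfl rfl
    obtain ⟨-, -, -, h0', h1', h2'⟩ := (isTypeZero_iff hq).1 h'
    have : ((LinearMap.toMatrixAlgEquiv v).toAlgHom.comp ρ').comp
        (RingQuot.mkAlgHom ℂ (SkeinRel q)) = FreeAlgebra.lift ℂ (G σ') := by
      refine FreeAlgebra.hom_ext (funext fun m => ?_)
      have e : ρ' (RingQuot.mkAlgHom ℂ (SkeinRel q) (FreeAlgebra.ι ℂ m)) =
          slopeFun (diagOp v (weight q σ')) (hop v (fun i => S i σ') (fun i => T i σ'))
            (hopOne q v (weight q σ') (fun i => S i σ') (fun i => T i σ')) m := by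
        cases m with
        | zero => exact h0'
        | infty => exact h1'
        | one => exact h2'
      simp [G, e]
    exact DFunLike.congr_fun this y
  -- for generic `σ'` the matrix is scalar, equivalently it is its entry at `(0, 0)` times `1`
  have hev : ∀ᶠ σ' in 𝓝[≠] σ, FreeAlgebra.lift ℂ (G σ') y =
      FreeAlgebra.lift ℂ (G σ') y 0 0 • (1 : Matrix (ZMod (ordTwo q)) (ZMod (ordTwo q)) ℂ) := by
    filter_upwards [eventually_generic hq w σ] with σ' hσ'
    obtain ⟨ρ', hρ'⟩ := exists_isTypeZero hq v (s := fun i => S i σ') (t := fun i => T i σ')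
      hσ'.1 (isGeneral_of_sq_ne_one hσ'.1 hσ'.2.1) (fun i => hST i σ')
    obtain ⟨c, hc⟩ := hρ'.exists_eq_smul_one_of_generic hq hσ'.2.1 hσ'.2.2 hz
    have := hrep σ' _ _ ρ' hρ' rfl rfl
    rw [hc, map_smul, map_one] at this
    rw [← this]
    simp
  have hlim : FreeAlgebra.lift ℂ (G σ) y =
      FreeAlgebra.lift ℂ (G σ) y 0 0 • (1 : Matrix (ZMod (ordTwo q)) (ZMod (ordTwo q)) ℂ) := by
    have hF' : ContinuousAt (fun σ' => FreeAlgebra.lift ℂ (G σ') y 0 0 •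
        (1 : Matrix (ZMod (ordTwo q)) (ZMod (ordTwo q)) ℂ)) σ :=
      (continuousAt_pi.1 (continuousAt_pi.1 hF 0) 0).smul continuousAt_const
    exact tendsto_nhds_unique_of_eventuallyEq (hF.tendsto.mono_left nhdsWithin_le_nhds)
      (hF'.tendsto.mono_left nhdsWithin_le_nhds) hev
  refine ⟨FreeAlgebra.lift ℂ (G σ) y 0 0, (LinearMap.toMatrixAlgEquiv v).injective ?_⟩
  rw [hrep σ s t ρ h (funext fun i => (hSσ i).symm) (funext fun i => (hTσ i).symm), map_smul,
    map_one]
  exact hlim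

theorem IsTypeZero.exists_isClassicalShadow (hq : q ≠ 0) (h : IsTypeZero q v σ w s t ρ) :
    ∃ χ : Center q →ₐ[ℂ] ℂ, IsClassicalShadow q ρ χ := by
  have : Nontrivial V := ⟨v 0, 0, v.ne_zero 0⟩
  let f : Center q →ₐ[ℂ] Module.End ℂ V := ρ.comp (Center q).val
  have hf : ∀ x, f x ∈ (⊥ : Subalgebra ℂ (Module.End ℂ V)) := fun x => by
    obtain ⟨c, hc⟩ := h.exists_eq_smul_one hq x.2
    exact Algebra.mem_bot.2 ⟨c, by rw [Algebra.algebraMap_eq_smul_one]; exact hc.symm⟩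
  let e := Algebra.botEquivOfInjective (FaithfulSMul.algebraMap_injective ℂ (Module.End ℂ V))
  refine ⟨e.toAlgHom.comp (f.codRestrict ⊥ hf), fun x => ?_⟩
  have h1 := e.symm_apply_apply (f.codRestrict ⊥ hf x)
  have h2 := congrArg Subtype.val h1
  rw [← Algebra.algebraMap_eq_smul_one]
  exact h2.symm

end deformation

/-! ### Threading a periodic Jacobi operator -/

section cover

variable {n : ℕ}

theorem prod_range_zmod [NeZero n] (f : ZMod n → ℂ) :
    ∏ i ∈ Finset.range n, f (i : ZMod n) = ∏ i, f i := by
  refine Finset.prod_bij' (fun i _ => (i : ZMod n)) (fun i _ => i.val)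
    (fun i _ => Finset.mem_univ _) (fun i _ => Finset.mem_range.2 (ZMod.val_lt i))
    (fun i hi => ?_) (fun i _ => ?_) (fun i _ => rfl)
  · exact ZMod.val_cast_of_lt (Finset.mem_range.1 hi)
  · exact ZMod.natCast_zmod_val i

/-- Link coefficients, from `j` up to `j + 1`, of the normalized operator on the universal cover:
moving away from `0` costs nothing. -/
def upCoeff (r : ZMod n → ℂ) (j : ℤ) : ℂ := if 0 ≤ j then 1 else r j

/-- Link coefficients, from `j + 1` down to `j`, of the normalized operator on the universal
cover. -/
def downCoeff (r : ZMod n → ℂ) (j : ℤ) : ℂ := if j < 0 then 1 else r j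

/-- The lift of a hopping operator on `ℤ/n` to the universal cover `ℤ`, in a basis in which it
depends only on the ratios `r_i = s_i t_i`. -/
def coverOp (r : ZMod n → ℂ) : Module.End ℂ (ℤ →₀ ℂ) :=
  Finsupp.linearCombination ℂ fun j : ℤ =>
    Finsupp.single (j + 1) (upCoeff r j) + Finsupp.single (j - 1) (downCoeff r (j - 1))

theorem coverOp_apply (r : ZMod n → ℂ) (y : ℤ →₀ ℂ) (j : ℤ) :
    coverOp r y j = upCoeff r (j - 1) * y (j - 1) + downCoeff r j * y (j + 1) := by
  have : Finsupp.lapply j ∘ₗ coverOp r =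
      upCoeff r (j - 1) • (Finsupp.lapply (j - 1) : (ℤ →₀ ℂ) →ₗ[ℂ] ℂ) +
        downCoeff r j • (Finsupp.lapply (j + 1) : (ℤ →₀ ℂ) →ₗ[ℂ] ℂ) := by
    refine Finsupp.lhom_ext' fun i => LinearMap.ext_ring ?_
    simp only [coverOp, LinearMap.coe_comp, Function.comp_apply, Finsupp.lsingle_apply,
      Finsupp.linearCombination_single, one_smul, Finsupp.lapply_apply, Finsupp.add_apply,
      LinearMap.add_apply, LinearMap.smul_apply, smul_eq_mul]
    congr 1
    · by_cases h : i + 1 = j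
      · rw [← h]; simp
      · rw [Finsupp.single_eq_of_ne (Ne.symm h),
          Finsupp.single_eq_of_ne (fun h' => h (by omega)), mul_zero]
    · by_cases h : i - 1 = j
      · rw [← h]; simp
      · rw [Finsupp.single_eq_of_ne (Ne.symm h),
          Finsupp.single_eq_of_ne (fun h' => h (by omega)), mul_zero]
  exact LinearMap.congr_fun this y

/-- `T_k` of the lifted operator, applied to the base vector. -/
def coverVec (r : ZMod n → ℂ) (k : ℕ) : ℤ →₀ ℂ :=
  aeval (coverOp r) (cheb k) (Finsupp.single 0 1)

theorem coverVec_zero (r : ZMod n → ℂ) : coverVec r 0 = Finsupp.single 0 2 := by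
  simp only [coverVec, cheb, Nat.cast_zero, Chebyshev.C_zero, map_ofNat]
  rw [Module.End.ofNat_apply, ofNat_smul_eq_nsmul, Finsupp.smul_single]
  norm_num

theorem coverVec_one (r : ZMod n → ℂ) :
    coverVec r 1 = Finsupp.single 1 1 + Finsupp.single (-1) 1 := by
  simp [coverVec, cheb, coverOp, upCoeff, downCoeff]

theorem coverVec_add_two (r : ZMod n → ℂ) (k : ℕ) (j : ℤ) :
    coverVec r (k + 2) j = upCoeff r (j - 1) * coverVec r (k + 1) (j - 1)
      + downCoeff r j * coverVec r (k + 1) (j + 1) - coverVec r k j := by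
  rw [← coverOp_apply, ← Finsupp.sub_apply]
  congr 1
  simp only [coverVec, cheb]
  push_cast
  rw [Chebyshev.C_add_two, map_sub, map_mul, aeval_X]
  rfl

theorem coverVec_eq_zero_of_lt (r : ZMod n → ℂ) (k : ℕ) (j : ℤ) (hj : (k : ℤ) < |j|) :
    coverVec r k j = 0 := by
  induction k using Nat.twoStepInduction generalizing j with
  | zero =>
    rw [coverVec_zero, Finsupp.single_eq_of_ne]
    rintro rfl
    simp at hj
  | one =>
    rw [coverVec_one, Finsupp.add_apply, Finsupp.single_eq_of_ne, Finsupp.single_eq_of_ne, add_zero]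
    all_goals
      rintro rfl
      simp at hj
  | more k h1 h2 =>
    push_cast at *
    rw [coverVec_add_two, h2, h2, h1]
    · ring
    all_goals grind

/-- The outermost coefficients come from the two straight paths, all links of which cost nothing. -/
theorem coverVec_top (r : ZMod n → ℂ) {k : ℕ} (hk : 0 < k) :
    coverVec r k k = 1 ∧ coverVec r k (-k) = 1 := by
  induction k, hk using Nat.le_induction with
  | base =>
    rw [Nat.succ_eq_add_one, zero_add, coverVec_one]
    simp
  | succ k hk ih =>
    obtain ⟨m, rfl⟩ := Nat.exists_eq_add_of_le' hk
    have e1 : ((m + 1 + 1 : ℕ) : ℤ) - 1 = (m + 1 : ℕ) := by push_cast; ring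
    have e2 : -((m + 1 + 1 : ℕ) : ℤ) + 1 = -(m + 1 : ℕ) := by push_cast; ring
    constructor
    · rw [coverVec_add_two, e1, ih.1, coverVec_eq_zero_of_lt r (m + 1) (_ + 1) (by push_cast; grind),
        coverVec_eq_zero_of_lt r m _ (by push_cast; grind), upCoeff, if_pos (by omega)]
      ring
    · rw [coverVec_add_two, e2, ih.2, coverVec_eq_zero_of_lt r (m + 1) (_ - 1) (by push_cast; grind),
        coverVec_eq_zero_of_lt r m _ (by push_cast; grind), downCoeff, if_pos (by omega)]
      ring

/-- Paths change the parity of the position in every step. -/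
theorem coverVec_eq_zero_of_odd (r : ZMod n → ℂ) (k : ℕ) (j : ℤ) (hj : Odd (j + k)) :
    coverVec r k j = 0 := by
  induction k using Nat.twoStepInduction generalizing j with
  | zero =>
    rw [coverVec_zero, Finsupp.single_eq_of_ne]
    rintro rfl
    simp at hj
  | one =>
    rw [coverVec_one, Finsupp.add_apply, Finsupp.single_eq_of_ne, Finsupp.single_eq_of_ne, add_zero]
    all_goals
      rintro rfl
      revert hj
      decide
  | more k h1 h2 =>
    push_cast at *
    rw [coverVec_add_two, h2, h2, h1]
    · ring
    all_goals grind

/-- The weight of the shortest path from `0` to `j` on the universal cover. -/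
def pathWeight (s t : ZMod n → ℂ) (j : ℤ) : ℂ :=
  if 0 ≤ j then ∏ i ∈ Finset.range j.toNat, s (i : ZMod n)
  else ∏ i ∈ Finset.range (-j).toNat, t (-(i + 1) : ZMod n)

theorem pathWeight_natCast (s t : ZMod n → ℂ) (k : ℕ) :
    pathWeight s t k = ∏ i ∈ Finset.range k, s (i : ZMod n) := by
  simp [pathWeight]

theorem pathWeight_neg (s t : ZMod n → ℂ) (k : ℕ) :
    pathWeight s t (-k) = ∏ i ∈ Finset.range k, t (-(i + 1) : ZMod n) := by
  cases k with
  | zero => simp [pathWeight]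
  | succ k => rw [pathWeight, if_neg (by push_cast; omega)]; simp

theorem pathWeight_mul_up {r s t : ZMod n → ℂ} (hr : ∀ i, s i * t i = r i) (j : ℤ) :
    pathWeight s t j * s j = upCoeff r j * pathWeight s t (j + 1) := by
  obtain ⟨k, rfl | rfl⟩ := j.eq_nat_or_neg
  · rw [upCoeff, if_pos (by omega), show (k : ℤ) + 1 = ((k + 1 : ℕ) : ℤ) by push_cast; rfl,
      pathWeight_natCast, pathWeight_natCast, Finset.prod_range_succ]
    simp
  · cases k with
    | zero => simp [pathWeight, upCoeff]
    | succ k =>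
      rw [upCoeff, if_neg (by push_cast; omega), pathWeight_neg,
        show -((k + 1 : ℕ) : ℤ) + 1 = -(k : ℤ) by push_cast; ring, pathWeight_neg,
        Finset.prod_range_succ, ← hr]
      push_cast
      ring

theorem pathWeight_mul_down {r s t : ZMod n → ℂ} (hr : ∀ i, s i * t i = r i) (j : ℤ) :
    pathWeight s t j * t ((j - 1 : ℤ) : ZMod n) =
      downCoeff r (j - 1) * pathWeight s t (j - 1) := by
  obtain ⟨k, rfl | rfl⟩ := j.eq_nat_or_neg
  · cases k with
    | zero =>
      simp [downCoeff, pathWeight]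
    | succ k =>
      rw [downCoeff, if_neg (by push_cast; omega), pathWeight_natCast,
        show ((k + 1 : ℕ) : ℤ) - 1 = (k : ℤ) by push_cast; ring, pathWeight_natCast,
        Finset.prod_range_succ, ← hr]
      push_cast
      ring
  · rw [downCoeff, if_pos (by omega), pathWeight_neg,
      show -(k : ℤ) - 1 = -((k + 1 : ℕ) : ℤ) by push_cast; ring, pathWeight_neg,
      Finset.prod_range_succ]
    push_cast
    ring

variable {V : Type*} [AddCommGroup V] [Module ℂ V]

/-- The projection from the universal cover, which intertwines `coverOp` with `hop`. -/
def coverProj (v : Module.Basis (ZMod n) ℂ V) (s t : ZMod n → ℂ) : (ℤ →₀ ℂ) →ₗ[ℂ] V :=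
  Finsupp.linearCombination ℂ fun j : ℤ => pathWeight s t j • v j

theorem hop_comp_coverProj (v : Module.Basis (ZMod n) ℂ V) {r s t : ZMod n → ℂ}
    (hr : ∀ i, s i * t i = r i) :
    hop v s t ∘ₗ coverProj v s t = coverProj v s t ∘ₗ coverOp r := by
  refine Finsupp.lhom_ext' fun j => LinearMap.ext_ring ?_
  simp only [coverProj, coverOp, LinearMap.coe_comp, Function.comp_apply, Finsupp.lsingle_apply,
    Finsupp.linearCombination_single, one_smul, map_add, map_smul, hop_apply, smul_add, smul_smul]
  rw [← pathWeight_mul_up hr, ← pathWeight_mul_down hr]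
  push_cast
  simp only [one_mul]

theorem aeval_comp_of_comp {M M' : Type*} [AddCommGroup M] [Module ℂ M] [AddCommGroup M']
    [Module ℂ M'] {f : Module.End ℂ M} {g : Module.End ℂ M'} {φ : M →ₗ[ℂ] M'}
    (h : g ∘ₗ φ = φ ∘ₗ f) (p : ℂ[X]) : aeval g p ∘ₗ φ = φ ∘ₗ aeval f p := by
  induction p using Polynomial.induction_on' with
  | add p p' hp hp' => rw [map_add, map_add, LinearMap.add_comp, LinearMap.comp_add, hp, hp']
  | monomial k c =>
    rw [aeval_monomial, aeval_monomial]
    have hk : (g ^ k) ∘ₗ φ = φ ∘ₗ (f ^ k) := by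
      induction k with
      | zero => rfl
      | succ k ih =>
        rw [pow_succ, pow_succ, Module.End.mul_eq_comp, Module.End.mul_eq_comp, LinearMap.comp_assoc,
          h, ← LinearMap.comp_assoc, ih, LinearMap.comp_assoc]
    ext y
    have := LinearMap.congr_fun hk y
    simp only [LinearMap.coe_comp, Function.comp_apply] at this
    simp [this]

/-- The diagonal entry of `T_n` of a hopping operator on `ℤ/n`: besides the two paths that wind
once around the cycle, it depends only on the ratios `r_i`. -/
theorem repr_aeval_cheb_hop [NeZero n] (v : Module.Basis (ZMod n) ℂ V) {r s t : ZMod n → ℂ}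
    (hr : ∀ i, s i * t i = r i) :
    v.repr (aeval (hop v s t) (cheb n) (v 0)) 0 = ∏ i, s i + ∏ i, t i + coverVec r n 0 := by
  have hn := NeZero.pos n
  have h0 : v 0 = coverProj v s t (Finsupp.single 0 1) := by simp [coverProj, pathWeight]
  have h1 := LinearMap.congr_fun (aeval_comp_of_comp (hop_comp_coverProj v hr) (cheb n))
    (Finsupp.single 0 1)
  simp only [LinearMap.coe_comp, Function.comp_apply] at h1
  rw [h0, h1]
  change v.repr (coverProj v s t (coverVec r n)) 0 = _
  have h2 : v.repr (coverProj v s t (coverVec r n)) 0 =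
      (coverVec r n).sum fun j c => c * (pathWeight s t j * if (j : ZMod n) = 0 then 1 else 0) := by
    rw [coverProj, Finsupp.linearCombination_apply, map_finsuppSum, Finsupp.sum, Finsupp.sum,
      Finsupp.finsetSum_apply]
    refine Finset.sum_congr rfl fun j _ => ?_
    by_cases h : (j : ZMod n) = 0 <;> simp [h]
  have hsupp : (coverVec r n).support ⊆ Finset.Icc (-(n : ℤ)) n := by
    intro j hj
    by_contra hj'
    refine Finsupp.mem_support_iff.1 hj (coverVec_eq_zero_of_lt r n j ?_)
    simp only [Finset.mem_Icc] at hj'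
    grind
  -- the positions in `[-n, n]` lying over `0` are `n`, `-n` and `0`
  rw [h2, Finsupp.sum_of_support_subset _ hsupp _ (by simp)]
  have hsub : ({(n : ℤ), -(n : ℤ), 0} : Finset ℤ) ⊆ Finset.Icc (-(n : ℤ)) n := by
    intro j hj
    simp only [Finset.mem_insert, Finset.mem_singleton] at hj
    rw [Finset.mem_Icc]
    omega
  rw [← Finset.sum_subset hsub]
  · rw [Finset.sum_insert (by simp; omega), Finset.sum_insert (by simp; omega),
      Finset.sum_singleton]
    have ht := coverVec_top r hn
    have e1 : ∏ i ∈ Finset.range n, t (-((i : ZMod n) + 1)) = ∏ i, t i := by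
      rw [prod_range_zmod fun i => t (-(i + 1))]
      exact Fintype.prod_equiv ((Equiv.addRight 1).trans (Equiv.neg _)) _ _ fun i => rfl
    rw [pathWeight_natCast, pathWeight_neg, prod_range_zmod, e1, ht.1, ht.2]
    simp [pathWeight]
    ring
  · intro j hj hj'
    have : (j : ZMod n) ≠ 0 := by
      rw [Ne, ZMod.intCast_zmod_eq_zero_iff_dvd]
      rintro ⟨m, rfl⟩
      apply hj'
      rw [Finset.mem_Icc] at hj
      have hm1 : m ≤ 1 := by nlinarith
      have hm2 : -1 ≤ m := by nlinarith
      interval_cases m <;> simp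
    rw [if_neg this, mul_zero, mul_zero]

end cover

/-- The contribution of the paths that do not wind around the cycle to the scalars by which `A_1`
and `A_∞` act. -/
def innerCoeff (q σ w : ℂ) : ℂ :=
  coverVec (fun i : ZMod (ordTwo q) => ratio q w (weight q σ i)) (ordTwo q) 0

theorem innerCoeff_of_odd {q σ w : ℂ} (h : Odd (ordTwo q)) : innerCoeff q σ w = 0 :=
  coverVec_eq_zero_of_odd _ _ _ (by simpa using h)

section threads

variable {q : ℂ} [NeZero (ordTwo q)] {V : Type*} [AddCommGroup V] [Module ℂ V]
  {v : Module.Basis (ZMod (ordTwo q)) ℂ V} {σ w : ℂ} {s t : ZMod (ordTwo q) → ℂ}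
  {ρ : Skein q →ₐ[ℂ] Module.End ℂ V}

theorem cycleProd_eq (s : ZMod (ordTwo q) → ℂ) : cycleProd q s = ∏ i, s i := by
  have h : cycleProd q s = ∏ i ∈ Finset.range (ordTwo q), s ((i : ZMod (ordTwo q)) + 1) := by
    rw [cycleProd, ← Finset.Ico_add_one_right_eq_Icc, Finset.prod_Ico_eq_prod_range]
    refine Finset.prod_congr (by simp) fun i _ => ?_
    rw [Nat.cast_add, Nat.cast_one, add_comm]
  rw [h, prod_range_zmod fun i => s (i + 1)]
  exact Fintype.prod_equiv (Equiv.addRight 1) _ _ fun i => rfl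

theorem aeval_cheb_hop {a b : ZMod (ordTwo q) → ℂ}
    (hr : ∀ i, a i * b i = ratio q w (weight q σ i)) {c : ℂ}
    (hc : aeval (hop v a b) (cheb (ordTwo q)) = c • (1 : Module.End ℂ V)) :
    c = ∏ i, a i + ∏ i, b i + innerCoeff q σ w := by
  rw [innerCoeff, ← repr_aeval_cheb_hop v hr, hc]
  simp

theorem IsTypeZero.apply_threadedCurve_infty (hq : q ≠ 0) (hκ : q ^ 2 - q⁻¹ ^ 2 ≠ 0)
    (h : IsTypeZero q v σ w s t ρ) : ρ (threadedCurve q .infty) =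
      (∏ i, s i + ∏ i, t i + innerCoeff q σ w) • (1 : Module.End ℂ V) := by
  obtain ⟨hσ, hg, hr, -, h1, -⟩ := (isTypeZero_iff hq).1 h
  obtain ⟨c, hc⟩ := h.exists_eq_smul_one hq (threadedCurve_mem_center hq hκ .infty)
  rw [hc]
  rw [map_threadedCurve, h1] at hc
  rw [aeval_cheb_hop hr hc]

theorem IsTypeZero.apply_threadedCurve_one (hq : q ≠ 0) (hκ : q ^ 2 - q⁻¹ ^ 2 ≠ 0)
    (h : IsTypeZero q v σ w s t ρ) : ρ (threadedCurve q .one) =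
      (∏ i, (q * weight q σ i * s i) + ∏ i, (q⁻¹ * (weight q σ i)⁻¹ * t i) + innerCoeff q σ w) •
        (1 : Module.End ℂ V) := by
  obtain ⟨hσ, hg, hr, -, -, h2⟩ := (isTypeZero_iff hq).1 h
  obtain ⟨c, hc⟩ := h.exists_eq_smul_one hq (threadedCurve_mem_center hq hκ .one)
  rw [hc]
  rw [map_threadedCurve, h2, hopOne] at hc
  rw [aeval_cheb_hop (σ := σ) (w := w) (fun i => ?_) hc]
  have := weight_ne_zero hq hσ i
  rw [← hr i]
  field_simp

end threads

/-! ### Products over a period -/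

theorem prod_range_sub_mul_pow {ζ : ℂ} {N : ℕ} (hN : 0 < N) (h : IsPrimitiveRoot ζ N) (a b : ℂ) :
    ∏ i ∈ Finset.range N, (a - ζ ^ i * b) = a ^ N - b ^ N := by
  rw [h.pow_sub_pow_eq_prod_sub_mul a b hN]
  refine Finset.prod_nbij (fun i => ζ ^ i) (fun i _ => ?_) (fun i hi j hj hij => ?_)
    (fun y hy => ?_) (fun i _ => rfl)
  · rw [mem_nthRootsFinset hN, ← pow_mul, mul_comm, pow_mul, h.pow_eq_one, one_pow]
  · exact h.pow_inj (Finset.mem_range.1 hi) (Finset.mem_range.1 hj) hij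
  · have : NeZero N := ⟨hN.ne'⟩
    obtain ⟨i, hi, rfl⟩ := h.eq_pow_of_pow_eq_one ((mem_nthRootsFinset hN 1).1 hy)
    exact ⟨i, Finset.mem_coe.2 (Finset.mem_range.2 hi), rfl⟩

section orders

variable {q : ℂ}

theorem ordFour_of_odd (h : Odd (ordTwo q)) : ordFour q = ordTwo q := by
  rw [ordFour, ordTwo, show q ^ 4 = (q ^ 2) ^ 2 by ring]
  exact Nat.Coprime.orderOf_pow h.coprime_two_right

theorem two_mul_ordFour_of_even (h : Even (ordTwo q)) : ordTwo q = 2 * ordFour q := by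
  have h2 : orderOf ((q ^ 2) ^ 2) = orderOf (q ^ 2) / 2 :=
    orderOf_pow_of_dvd two_ne_zero h.two_dvd
  rw [ordFour, show q ^ 4 = (q ^ 2) ^ 2 by ring, h2]
  exact (Nat.mul_div_cancel' h.two_dvd).symm

theorem ordFour_pos (hq : IsOfFinOrder q) : 0 < ordFour q := hq.pow.orderOf_pos

theorem pow_ordTwo_sq (q : ℂ) : (q ^ ordTwo q) ^ 2 = 1 := by
  rw [← pow_mul, mul_comm, pow_mul, pow_ordTwo]

theorem pow_ordTwo_of_even (hq : IsOfFinOrder q) (h : Even (ordTwo q)) : q ^ ordTwo q = -1 := by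
  rcases sq_eq_sq_iff_eq_or_eq_neg.1 ((pow_ordTwo_sq q).trans (one_pow 2).symm) with h1 | h1
  · exfalso
    have hN := ordFour_pos hq
    have h2 := two_mul_ordFour_of_even h
    have h3 : (q ^ 2) ^ ordFour q = 1 := by rw [← pow_mul, ← h2, h1]
    have := orderOf_le_of_pow_eq_one hN h3
    change ordTwo q ≤ _ at this
    omega
  · exact h1

/-- The exponents `n²` and `n` of `q` differ by a multiple of `2n`. -/
theorem eps_of_odd (h : Odd (ordTwo q)) : eps q = q ^ ordTwo q := by
  obtain ⟨k, hk⟩ := h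
  rw [eps, ordFour_of_odd ⟨k, hk⟩]
  have e : ordTwo q ^ 2 = ordTwo q + 2 * ordTwo q * k := by
    rw [sq]
    nth_rewrite 2 [hk]
    ring
  rw [e, pow_add, pow_mul, pow_mul, pow_ordTwo, one_pow, mul_one]

theorem eps_sq_of_even (hq : IsOfFinOrder q) (h : Even (ordTwo q)) :
    eps q ^ 2 = (-1) ^ ordFour q := by
  rw [eps, ← pow_mul, show ordFour q ^ 2 * 2 = 2 * ordFour q * ordFour q by ring, pow_mul,
    ← two_mul_ordFour_of_even h, pow_ordTwo_of_even hq h]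

end orders

section products

variable {q : ℂ} [NeZero (ordTwo q)] {σ : ℂ}

theorem prod_add_mul_sq_weight_of_odd (hq : IsOfFinOrder q) (h : Odd (ordTwo q)) (c d : ℂ) :
    ∏ i, (d + c * weight q σ i ^ 2) = d ^ ordTwo q + c ^ ordTwo q * (σ ^ ordTwo q) ^ 2 := by
  have hp : IsPrimitiveRoot (q ^ 4) (ordTwo q) := by
    rw [← ordFour_of_odd h]; exact IsPrimitiveRoot.orderOf _
  have := prod_range_sub_mul_pow (ordTwo_pos hq) hp d (-c * σ ^ 2)
  rw [mul_pow, h.neg_pow] at this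
  rw [← prod_range_zmod, pow_right_comm, ← sub_neg_eq_add, ← neg_mul, ← this]
  refine Finset.prod_congr rfl fun i hi => ?_
  rw [weight_eq, ZMod.val_cast_of_lt (Finset.mem_range.1 hi)]
  ring

theorem prod_add_mul_sq_weight_of_even (hq : IsOfFinOrder q) (h : Even (ordTwo q)) (c d : ℂ) :
    ∏ i, (d + c * weight q σ i ^ 2) =
      (d ^ ordFour q - (-c) ^ ordFour q * σ ^ ordTwo q) ^ 2 := by
  have h2 := two_mul_ordFour_of_even h
  have hp : IsPrimitiveRoot (q ^ 4) (ordFour q) := IsPrimitiveRoot.orderOf _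
  have := prod_range_sub_mul_pow (ordFour_pos hq) hp d (-c * σ ^ 2)
  rw [mul_pow, ← pow_mul, ← h2] at this
  have e : ∏ i, (d + c * weight q σ i ^ 2) =
      ∏ i ∈ Finset.range (ordTwo q), (d - (q ^ 4) ^ i * (-c * σ ^ 2)) := by
    rw [← prod_range_zmod]
    refine Finset.prod_congr rfl fun i hi => ?_
    rw [weight_eq, ZMod.val_cast_of_lt (Finset.mem_range.1 hi)]
    ring
  rw [e, ← this]
  nth_rewrite 1 [h2]
  rw [two_mul, Finset.prod_range_add]
  simp only [pow_add, hp.pow_eq_one, one_mul]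
  exact (sq _).symm

theorem prod_weight_of_odd (h : Odd (ordTwo q)) :
    ∏ i, weight q σ i = σ ^ ordTwo q := by
  obtain ⟨k, hk⟩ := h
  have e : ∏ i, weight q σ i = ∏ i ∈ Finset.range (ordTwo q), ((q ^ 2) ^ i * σ) := by
    rw [← prod_range_zmod]
    refine Finset.prod_congr rfl fun i hi => ?_
    rw [weight_eq, ZMod.val_cast_of_lt (Finset.mem_range.1 hi)]
  rw [e, Finset.prod_mul_distrib, Finset.prod_const, Finset.card_range,
    Finset.prod_pow_eq_pow_sum, Finset.sum_range_id]
  have e2 : ordTwo q * (ordTwo q - 1) / 2 = ordTwo q * k := by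
    rw [hk, Nat.add_sub_cancel, show (2 * k + 1) * (2 * k) = (2 * k + 1) * k * 2 by ring,
      Nat.mul_div_cancel _ two_pos]
  rw [e2, pow_mul, pow_ordTwo, one_pow, one_mul]

theorem prod_weight_of_even (hq : IsOfFinOrder q) (h : Even (ordTwo q)) :
    ∏ i, weight q σ i = -σ ^ ordTwo q := by
  have h2 := two_mul_ordFour_of_even h
  have hN := ordFour_pos hq
  have e : ∏ i, weight q σ i = ∏ i ∈ Finset.range (ordTwo q), ((q ^ 2) ^ i * σ) := by
    rw [← prod_range_zmod]
    refine Finset.prod_congr rfl fun i hi => ?_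
    rw [weight_eq, ZMod.val_cast_of_lt (Finset.mem_range.1 hi)]
  rw [e, Finset.prod_mul_distrib, Finset.prod_const, Finset.card_range,
    Finset.prod_pow_eq_pow_sum, Finset.sum_range_id, ← pow_mul]
  have e2 : 2 * (ordTwo q * (ordTwo q - 1) / 2) = ordTwo q * (ordTwo q - 1) :=
    Nat.mul_div_cancel' ((h.two_dvd).mul_right _)
  have ho : Odd (ordTwo q - 1) := by
    refine Nat.Even.sub_odd (NeZero.pos (ordTwo q)) h odd_one
  rw [e2, pow_mul, pow_ordTwo_of_even hq h, ho.neg_one_pow, neg_one_mul]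

theorem prod_mul_weight_add_of_odd (hq : IsOfFinOrder q) (hσ : σ ≠ 0) (h : Odd (ordTwo q))
    (c d : ℂ) : ∏ i, (c * weight q σ i + d * (weight q σ i)⁻¹) =
      c ^ ordTwo q * σ ^ ordTwo q + d ^ ordTwo q * (σ ^ ordTwo q)⁻¹ := by
  have hq0 := ne_zero_of_isOfFinOrder hq
  have e : ∀ i, c * weight q σ i + d * (weight q σ i)⁻¹ =
      (d + c * weight q σ i ^ 2) * (weight q σ i)⁻¹ := fun i => by
    have := weight_ne_zero hq0 hσ i
    field_simp
    ring
  simp only [e]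
  rw [Finset.prod_mul_distrib, prod_add_mul_sq_weight_of_odd hq h, Finset.prod_inv_distrib,
    prod_weight_of_odd h]
  have := pow_ne_zero (ordTwo q) hσ
  field_simp
  ring

theorem prod_mul_weight_add_of_even (hq : IsOfFinOrder q) (hσ : σ ≠ 0) (h : Even (ordTwo q))
    (c d : ℂ) : ∏ i, (c * weight q σ i + d * (weight q σ i)⁻¹) =
      -(d ^ ordFour q - (-c) ^ ordFour q * σ ^ ordTwo q) ^ 2 * (σ ^ ordTwo q)⁻¹ := by
  have hq0 := ne_zero_of_isOfFinOrder hq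
  have e : ∀ i, c * weight q σ i + d * (weight q σ i)⁻¹ =
      (d + c * weight q σ i ^ 2) * (weight q σ i)⁻¹ := fun i => by
    have := weight_ne_zero hq0 hσ i
    field_simp
    ring
  simp only [e]
  rw [Finset.prod_mul_distrib, prod_add_mul_sq_weight_of_even hq h, Finset.prod_inv_distrib,
    prod_weight_of_even hq h, inv_neg, mul_neg, neg_mul]

theorem prod_weight_sub_inv_of_odd (hq : IsOfFinOrder q) (hσ : σ ≠ 0) (h : Odd (ordTwo q)) :
    ∏ i, (weight q σ i - (weight q σ i)⁻¹) = σ ^ ordTwo q - (σ ^ ordTwo q)⁻¹ := by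
  have := prod_mul_weight_add_of_odd hq hσ h 1 (-1)
  simpa [h.neg_one_pow, ← sub_eq_add_neg] using this

theorem prod_weight_sub_inv_of_even (hq : IsOfFinOrder q) (hσ : σ ≠ 0) (h : Even (ordTwo q)) :
    ∏ i, (weight q σ i - (weight q σ i)⁻¹) =
      -(1 - σ ^ ordTwo q) ^ 2 * (σ ^ ordTwo q)⁻¹ := by
  have := prod_mul_weight_add_of_even hq hσ h 1 (-1)
  have e : ((-1 : ℂ) ^ ordFour q - (-1) ^ ordFour q * σ ^ ordTwo q) ^ 2 =
      (1 - σ ^ ordTwo q) ^ 2 := by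
    rw [← mul_one_sub, mul_pow, ← pow_mul, mul_comm (ordFour q), pow_mul]
    norm_num
  rw [e] at this
  simpa [← sub_eq_add_neg] using this

end products

/-! ### Representations in which `α_∞` has an explicit eigenvector -/

section special

variable {q σ b γ : ℂ}

/-- Coefficients `s_i` for which, together with `specialDown`, the sum of the basis vectors is an
eigenvector of the operator `hop`. They come from the factorization of the numerator of `r_i`, for
`w = b + b⁻¹`, into `q x_i + b q⁻¹ x_i⁻¹` and `q x_i + b⁻¹ q⁻¹ x_i⁻¹`. -/
def specialUp (q σ b γ : ℂ) (i : ZMod (ordTwo q)) : ℂ :=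
  γ * (q * weight q σ i + b * q⁻¹ * (weight q σ i)⁻¹) /
    (weight q σ (i + 1) - (weight q σ (i + 1))⁻¹)

/-- Coefficients `t_i` matching `specialUp`. -/
def specialDown (q σ b γ : ℂ) (i : ZMod (ordTwo q)) : ℂ :=
  γ⁻¹ * (q * weight q σ i + b⁻¹ * q⁻¹ * (weight q σ i)⁻¹) /
    (weight q σ i - (weight q σ i)⁻¹)

theorem specialUp_mul_specialDown (hq : q ≠ 0) (hx : IsGeomSeq q (weight q σ)) (hb : b ≠ 0)
    (hγ : γ ≠ 0) (i : ZMod (ordTwo q)) :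
    specialUp q σ b γ i * specialDown q σ b γ i = ratio q (b + b⁻¹) (weight q σ i) := by
  have h1 := hx.sub_inv_ne_zero i
  have h2 := hx.sub_inv_ne_zero (i + 1)
  have h0 := hx.ne_zero i
  rw [specialUp, specialDown, ratio]
  have e : weight q σ (i + 1) - (weight q σ (i + 1))⁻¹ =
      q ^ 2 * weight q σ i - q⁻¹ ^ 2 * (weight q σ i)⁻¹ := by
    rw [hx.succ, mul_inv, inv_pow]
  rw [e] at h2 ⊢
  rw [div_mul_div_comm, mul_comm (q ^ 2 * weight q σ i - _)]
  congr 1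
  field_simp
  ring

/-- The coefficient of `v_i` in the image of `∑ v_j` does not depend on `i`, provided that
`γ² = -b⁻¹`. -/
theorem specialUp_add_specialDown (hq : q ≠ 0) (hx : IsGeomSeq q (weight q σ)) (hb : b ≠ 0)
    (hγ : γ ^ 2 = -b⁻¹) (i : ZMod (ordTwo q)) :
    specialUp q σ b γ (i - 1) + specialDown q σ b γ i = γ * q⁻¹ + (γ * q⁻¹)⁻¹ := by
  have h1 := hx.sub_inv_ne_zero i
  have h0 := hx.ne_zero i
  have hγ0 : γ ≠ 0 := by
    rintro rfl
    exact neg_ne_zero.2 (inv_ne_zero hb) (by rw [← hγ]; ring)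
  rw [specialUp, specialDown, sub_add_cancel, hx.pred hq, ← add_div, div_eq_iff h1]
  have hb' : b = -(γ ^ 2)⁻¹ := by rw [hγ, inv_neg, inv_inv, neg_neg]
  rw [hb']
  field_simp
  ring

variable [NeZero (ordTwo q)] {V : Type*} [AddCommGroup V] [Module ℂ V]
  {v : Module.Basis (ZMod (ordTwo q)) ℂ V}

theorem hop_special_sum (hq : q ≠ 0) (hx : IsGeomSeq q (weight q σ)) (hb : b ≠ 0)
    (hγ : γ ^ 2 = -b⁻¹) :
    hop v (specialUp q σ b γ) (specialDown q σ b γ) (∑ i, v i) =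
      (γ * q⁻¹ + (γ * q⁻¹)⁻¹) • ∑ i, v i := by
  simp only [map_sum, hop_apply, Finset.sum_add_distrib]
  rw [← Equiv.sum_comp (Equiv.subRight (1 : ZMod (ordTwo q)))
      (fun i => specialUp q σ b γ i • v (i + 1)),
    ← Equiv.sum_comp (Equiv.addRight (1 : ZMod (ordTwo q)))
      (fun i => specialDown q σ b γ (i - 1) • v (i - 1)), Finset.smul_sum, ← Finset.sum_add_distrib]
  refine Finset.sum_congr rfl fun i _ => ?_
  simp only [Equiv.subRight_apply, Equiv.coe_addRight, sub_add_cancel, add_sub_cancel_right]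
  rw [← add_smul, specialUp_add_specialDown hq hx hb hγ]

theorem prod_specialUp : ∏ i, specialUp q σ b γ i = γ ^ ordTwo q *
    (∏ i, (q * weight q σ i + b * q⁻¹ * (weight q σ i)⁻¹)) /
      ∏ i, (weight q σ i - (weight q σ i)⁻¹) := by
  simp only [specialUp]
  rw [Finset.prod_div_distrib, Finset.prod_mul_distrib, Finset.prod_const, Finset.card_univ,
    ZMod.card, ← Equiv.prod_comp (Equiv.addRight (1 : ZMod (ordTwo q)))
      (fun i => weight q σ i - (weight q σ i)⁻¹)]
  rfl

theorem prod_specialDown : ∏ i, specialDown q σ b γ i = γ⁻¹ ^ ordTwo q *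
    (∏ i, (q * weight q σ i + b⁻¹ * q⁻¹ * (weight q σ i)⁻¹)) /
      ∏ i, (weight q σ i - (weight q σ i)⁻¹) := by
  simp only [specialDown]
  rw [Finset.prod_div_distrib, Finset.prod_mul_distrib, Finset.prod_const, Finset.card_univ,
    ZMod.card]

theorem exists_special (w : ℂ) : ∃ b γ : ℂ, b ≠ 0 ∧ γ ≠ 0 ∧ b + b⁻¹ = w ∧ γ ^ 2 = -b⁻¹ := by
  obtain ⟨b, hb, hw⟩ := exists_add_inv_eq w
  obtain ⟨γ, hγ⟩ := IsAlgClosed.exists_pow_nat_eq (-b⁻¹) (n := 2) two_pos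
  refine ⟨b, γ, hb, ?_, hw, hγ⟩
  rintro rfl
  exact neg_ne_zero.2 (inv_ne_zero hb) (by rw [← hγ]; ring)

/-- The scalar by which `A_∞` acts, computed on the eigenvector `∑ v_i` and by counting paths. -/
theorem innerCoeff_special (hq : IsOfFinOrder q) (hκ : q ^ 2 - q⁻¹ ^ 2 ≠ 0) (hσ : σ ≠ 0)
    (hg : IsGeneral q (zZero q σ)) (hb : b ≠ 0) (hγ0 : γ ≠ 0) (hγ : γ ^ 2 = -b⁻¹) :
    (γ * q⁻¹) ^ ordTwo q + (γ * q⁻¹)⁻¹ ^ ordTwo q =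
      ∏ i, specialUp q σ b γ i + ∏ i, specialDown q σ b γ i + innerCoeff q σ (b + b⁻¹) := by
  have hq0 := ne_zero_of_isOfFinOrder hq
  have hx := isGeomSeq_weight hq0 hσ hg
  let v := Pi.basisFun ℂ (ZMod (ordTwo q))
  obtain ⟨ρ, hρ⟩ := exists_isTypeZero hq0 v hσ hg (specialUp_mul_specialDown hq0 hx hb hγ0)
  have h1 := hρ.apply_threadedCurve_infty hq0 hκ
  rw [map_threadedCurve, ((isTypeZero_iff hq0).1 hρ).2.2.2.2.1] at h1
  have hne : ∑ i, v i ≠ 0 := by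
    intro h
    have := congrFun h 0
    simp [v, Pi.basisFun_apply, Pi.single_apply] at this
  have h2 := Module.End.aeval_apply_of_hasEigenvector (p := cheb (ordTwo q))
    ⟨Module.End.mem_eigenspace_iff.2 (hop_special_sum (v := v) hq0 hx hb hγ), hne⟩
  rw [h1, eval_cheb (mul_ne_zero hγ0 (inv_ne_zero hq0)), LinearMap.smul_apply,
    Module.End.one_apply] at h2
  exact (smul_left_injective ℂ hne h2).symm

/-- For even `D`, the contribution of the non-winding paths and the product of all ratios. Both depend
only on `σ` and `w`, so they may be read off from the coefficients `specialUp`, `specialDown`. -/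
theorem even_special (hq : IsOfFinOrder q) (hκ : q ^ 2 - q⁻¹ ^ 2 ≠ 0) (hσ : σ ≠ 0)
    (hg : IsGeneral q (zZero q σ)) (he : Even (ordTwo q)) (w : ℂ) :
    innerCoeff q σ w = corr q (zZero q σ) w ∧ ∏ i, ratio q w (weight q σ i) =
      ((eps q ^ 2 * chebN q w + zZero q σ) / (zZero q σ - 2)) ^ 2 := by
  obtain ⟨b, γ, hb, hγ0, rfl, hγ⟩ := exists_special w
  have hq0 := ne_zero_of_isOfFinOrder hq
  have hx := isGeomSeq_weight hq0 hσ hg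
  have h1 := innerCoeff_special hq hκ hσ hg hb hγ0 hγ
  have h2 : ∏ i, ratio q (b + b⁻¹) (weight q σ i) =
      (∏ i, specialUp q σ b γ i) * ∏ i, specialDown q σ b γ i := by
    rw [← Finset.prod_mul_distrib]
    exact Finset.prod_congr rfl fun i _ => (specialUp_mul_specialDown hq0 hx hb hγ0 i).symm
  -- everything is expressed by `S = σ ^ D` and `B = (-b) ^ N`, where `D = 2N`
  have hn := two_mul_ordFour_of_even he
  have hγn : γ ^ ordTwo q = ((-b) ^ ordFour q)⁻¹ := by
    rw [hn, pow_mul, hγ, ← inv_neg, inv_pow]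
  have hqn : (q ^ ordFour q) ^ 2 = -1 := by
    rw [← pow_mul, mul_comm, ← hn, pow_ordTwo_of_even hq he]
  have hqi : (q ^ ordFour q)⁻¹ = -q ^ ordFour q := by
    exact inv_eq_of_mul_eq_one_right (by linear_combination -hqn)
  have hm : ((-1 : ℂ) ^ ordFour q) ^ 2 = 1 := by
    rw [← pow_mul, mul_comm, pow_mul]; norm_num
  have hmi : ((-1 : ℂ) ^ ordFour q)⁻¹ = (-1) ^ ordFour q :=
    inv_eq_of_mul_eq_one_right (by rw [← sq, hm])
  have hbN : b ^ ordFour q = (-1) ^ ordFour q * (-b) ^ ordFour q := by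
    rw [← mul_pow]; norm_num
  have hB : (-b) ^ ordFour q ≠ 0 := pow_ne_zero _ (neg_ne_zero.2 hb)
  have hS : σ ^ ordTwo q ≠ 0 := pow_ne_zero _ hσ
  have hS1 : 1 - σ ^ ordTwo q ≠ 0 := by
    intro h
    have : σ ^ ordTwo q = 1 := by linear_combination -h
    have hz : zZero q σ = 2 := by rw [zZero, inv_pow, this]; norm_num
    rcases hg with hg | hg
    · exact hg.1 hz
    · rw [hz] at hg; norm_num at hg
  have hT : eps q ^ 2 * chebN q (b + b⁻¹) = (-b) ^ ordFour q + ((-b) ^ ordFour q)⁻¹ := by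
    rw [eps_sq_of_even hq he, chebN, eval_cheb hb, inv_pow, hbN, mul_inv, mul_add, ← mul_assoc,
      ← sq, hm, one_mul, ← mul_assoc, mul_inv_cancel₀ (by
        intro h; rw [h] at hm; norm_num at hm), one_mul]
  have hup : ∏ i, specialUp q σ b γ i = -((-b) ^ ordFour q)⁻¹ *
      ((-b) ^ ordFour q + σ ^ ordTwo q) ^ 2 / (1 - σ ^ ordTwo q) ^ 2 := by
    rw [prod_specialUp, prod_mul_weight_add_of_even hq hσ he, prod_weight_sub_inv_of_even hq hσ he,
      hγn, mul_pow, inv_pow, hqi, hbN, neg_pow q]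
    rw [show ((-1) ^ ordFour q * (-b) ^ ordFour q * -q ^ ordFour q -
        (-1) ^ ordFour q * q ^ ordFour q * σ ^ ordTwo q) ^ 2 =
        -((-b) ^ ordFour q + σ ^ ordTwo q) ^ 2 by
      linear_combination ((-b) ^ ordFour q + σ ^ ordTwo q) ^ 2 * (q ^ ordFour q) ^ 2 * hm +
        ((-b) ^ ordFour q + σ ^ ordTwo q) ^ 2 * hqn]
    field_simp
  have hdown : ∏ i, specialDown q σ b γ i = -((-b) ^ ordFour q) *
      (((-b) ^ ordFour q)⁻¹ + σ ^ ordTwo q) ^ 2 / (1 - σ ^ ordTwo q) ^ 2 := by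
    rw [prod_specialDown, prod_mul_weight_add_of_even hq hσ he,
      prod_weight_sub_inv_of_even hq hσ he, inv_pow γ, hγn, mul_pow, inv_pow, inv_pow, hqi, hbN,
      neg_pow q, mul_inv, hmi]
    rw [show ((-1) ^ ordFour q * ((-b) ^ ordFour q)⁻¹ * -q ^ ordFour q -
        (-1) ^ ordFour q * q ^ ordFour q * σ ^ ordTwo q) ^ 2 =
        -(((-b) ^ ordFour q)⁻¹ + σ ^ ordTwo q) ^ 2 by
      linear_combination
        (((-b) ^ ordFour q)⁻¹ + σ ^ ordTwo q) ^ 2 * (q ^ ordFour q) ^ 2 * hm +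
        (((-b) ^ ordFour q)⁻¹ + σ ^ ordTwo q) ^ 2 * hqn]
    field_simp
  have hz : zZero q σ - 2 = (1 - σ ^ ordTwo q) ^ 2 / σ ^ ordTwo q := by
    rw [zZero, inv_pow]
    field_simp
    ring
  constructor
  · have h3 : innerCoeff q σ (b + b⁻¹) = (γ * q⁻¹) ^ ordTwo q + (γ * q⁻¹)⁻¹ ^ ordTwo q -
        (∏ i, specialUp q σ b γ i + ∏ i, specialDown q σ b γ i) := by rw [h1]; ring
    rw [h3, hup, hdown, corr, hz, mul_assoc, hT, inv_pow (γ * q⁻¹), mul_pow, hγn, inv_pow,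
      pow_ordTwo_of_even hq he]
    generalize (-b) ^ ordFour q = B at *
    field_simp
    ring
  · rw [h2, hup, hdown, hT, hz, zZero, inv_pow]
    generalize (-b) ^ ordFour q = B at *
    field_simp
    ring

theorem prod_ratio_of_odd (hq : IsOfFinOrder q) (hσ : σ ≠ 0)
    (hg : IsGeneral q (zZero q σ)) (ho : Odd (ordTwo q)) (w : ℂ) :
    ∏ i, ratio q w (weight q σ i) =
      (zZero q σ ^ 2 - 2 + chebN q w) / (σ ^ ordTwo q - (σ ^ ordTwo q)⁻¹) ^ 2 := by
  obtain ⟨b, γ, hb, hγ0, rfl, hγ⟩ := exists_special w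
  have hq0 := ne_zero_of_isOfFinOrder hq
  have hx := isGeomSeq_weight hq0 hσ hg
  have h2 : ∏ i, ratio q (b + b⁻¹) (weight q σ i) =
      (∏ i, specialUp q σ b γ i) * ∏ i, specialDown q σ b γ i := by
    rw [← Finset.prod_mul_distrib]
    exact Finset.prod_congr rfl fun i _ => (specialUp_mul_specialDown hq0 hx hb hγ0 i).symm
  have hS : σ ^ ordTwo q ≠ 0 := pow_ne_zero _ hσ
  have hbn : b ^ ordTwo q ≠ 0 := pow_ne_zero _ hb
  have hγn : γ ^ ordTwo q ≠ 0 := pow_ne_zero _ hγ0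
  have hqn := pow_ordTwo_sq q
  have hqi : (q ^ ordTwo q)⁻¹ = q ^ ordTwo q := inv_eq_of_mul_eq_one_left (by rw [← sq, hqn])
  rw [h2, prod_specialUp, prod_specialDown, prod_mul_weight_add_of_odd hq hσ ho,
    prod_mul_weight_add_of_odd hq hσ ho, prod_weight_sub_inv_of_odd hq hσ ho, chebN,
    ordFour_of_odd ho, eval_cheb hb, zZero]
  simp only [mul_pow, inv_pow, hqi]
  rw [div_mul_div_comm, ← sq]
  congr 1
  generalize q ^ ordTwo q = Q at *
  generalize b ^ ordTwo q = B at *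
  field_simp
  linear_combination (B * (σ ^ ordTwo q) ^ 4 + (B ^ 2 + 1) * (σ ^ ordTwo q) ^ 2 + B) * hqn

end special

/-! ### The action of the threaded curves -/

theorem eps_inv_of_odd {q : ℂ} (ho : Odd (ordTwo q)) : (eps q)⁻¹ = eps q :=
  inv_eq_of_mul_eq_one_right (by rw [← sq, eps_of_odd ho, pow_ordTwo_sq])

section formulas

variable {q : ℂ} [NeZero (ordTwo q)] {V : Type*} [AddCommGroup V] [Module ℂ V]
  {v : Module.Basis (ZMod (ordTwo q)) ℂ V} {σ w : ℂ} {s t : ZMod (ordTwo q) → ℂ}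
  {ρ : Skein q →ₐ[ℂ] Module.End ℂ V}

theorem IsTypeZero.apply_threadedCurve_of_odd (hq : IsOfFinOrder q) (hκ : q ^ 2 - q⁻¹ ^ 2 ≠ 0)
    (h : IsTypeZero q v σ w s t ρ) (ho : Odd (ordTwo q)) :
    ρ (threadedCurve q .one) =
      (eps q * σ ^ ordTwo q * cycleProd q s + eps q * σ⁻¹ ^ ordTwo q * cycleProd q t) •
        (1 : Module.End ℂ V) ∧
    ρ (threadedCurve q .infty) = (cycleProd q s + cycleProd q t) • (1 : Module.End ℂ V) := by
  have hq0 := ne_zero_of_isOfFinOrder hq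
  have he := eps_inv_of_odd ho
  rw [h.apply_threadedCurve_one hq0 hκ, h.apply_threadedCurve_infty hq0 hκ, innerCoeff_of_odd ho,
    cycleProd_eq, cycleProd_eq, add_zero, add_zero]
  refine ⟨?_, rfl⟩
  congr 1
  simp only [Finset.prod_mul_distrib, Finset.prod_const, Finset.card_univ, ZMod.card,
    Finset.prod_inv_distrib, prod_weight_of_odd ho, inv_pow]
  rw [← eps_of_odd ho, he]

theorem IsTypeZero.apply_threadedCurve_of_even (hq : IsOfFinOrder q) (hκ : q ^ 2 - q⁻¹ ^ 2 ≠ 0)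
    (h : IsTypeZero q v σ w s t ρ) (he : Even (ordTwo q)) :
    ρ (threadedCurve q .one) =
      (σ ^ ordTwo q * cycleProd q s + σ⁻¹ ^ ordTwo q * cycleProd q t
        + corr q (zZero q σ) w) • (1 : Module.End ℂ V) ∧
    ρ (threadedCurve q .infty) =
      (cycleProd q s + cycleProd q t + corr q (zZero q σ) w) • (1 : Module.End ℂ V) := by
  have hq0 := ne_zero_of_isOfFinOrder hq
  rw [h.apply_threadedCurve_one hq0 hκ, h.apply_threadedCurve_infty hq0 hκ,
    (even_special hq hκ h.sigma_ne_zero h.general he w).1, cycleProd_eq, cycleProd_eq]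
  refine ⟨?_, rfl⟩
  congr 2
  simp only [Finset.prod_mul_distrib, Finset.prod_const, Finset.card_univ, ZMod.card,
    Finset.prod_inv_distrib, prod_weight_of_even hq he, inv_pow, pow_ordTwo_of_even hq he, inv_neg,
    inv_one, neg_mul_neg, one_mul]

end formulas

/-! ### Realizing the points of the shadow variety -/

/-- Any factorization of `∏ r_i` comes from factorizations of the `r_i`. If both factors vanish,
some `r_j` vanishes, and `s_j = t_j = 0` is a possible choice. -/
theorem exists_prod_eq {ι : Type*} [Fintype ι] [DecidableEq ι] [Nonempty ι] (r : ι → ℂ) {A B : ℂ}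
    (h : A * B = ∏ i, r i) :
    ∃ s t : ι → ℂ, ∏ i, s i = A ∧ ∏ i, t i = B ∧ ∀ i, s i * t i = r i := by
  have key : ∀ {A B : ℂ}, A ≠ 0 → A * B = ∏ i, r i →
      ∃ s t : ι → ℂ, ∏ i, s i = A ∧ ∏ i, t i = B ∧ ∀ i, s i * t i = r i := by
    intro A B hA h
    obtain ⟨j⟩ := ‹Nonempty ι›
    have hs : ∏ i, (if i = j then A else 1) = A := by simp
    refine ⟨fun i => if i = j then A else 1, fun i => r i / if i = j then A else 1, hs, ?_,
      fun i => ?_⟩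
    · rw [Finset.prod_div_distrib, hs, ← h, mul_div_cancel_left₀ _ hA]
    · refine mul_div_cancel₀ _ ?_
      simp only
      split_ifs
      exacts [hA, one_ne_zero]
  by_cases hA : A = 0
  · by_cases hB : B = 0
    · rw [hA, zero_mul, eq_comm, Finset.prod_eq_zero_iff] at h
      obtain ⟨j, -, hj⟩ := h
      refine ⟨fun i => if i = j then 0 else 1, fun i => if i = j then 0 else r i, ?_, ?_,
        fun i => ?_⟩
      · rw [hA]
        exact Finset.prod_eq_zero (Finset.mem_univ j) (if_pos rfl)
      · rw [hB]
        exact Finset.prod_eq_zero (Finset.mem_univ j) (if_pos rfl)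
      · by_cases hi : i = j <;> simp [hi, hj]
    · obtain ⟨t, s, ht, hs, hr⟩ := key hB (by rw [mul_comm, h])
      exact ⟨s, t, hs, ht, fun i => by rw [mul_comm, hr]⟩
  · exact key hA h

theorem exists_add_eq_mul_eq (S P : ℂ) : ∃ A B : ℂ, A + B = S ∧ A * B = P := by
  obtain ⟨x, hx⟩ := IsAlgClosed.exists_root (X ^ 2 - C S * X + C P : ℂ[X]) (by
    have : (X ^ 2 - C S * X + C P : ℂ[X]).degree = 2 := by compute_degree!
    rw [this]; norm_num)
  simp only [IsRoot.def, eval_add, eval_sub, eval_pow, eval_X, eval_mul, eval_C] at hx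
  exact ⟨x, S - x, by ring, by linear_combination -hx⟩

/-- The products `A = Π_s` and `B = Π_t` for given values of `A_1` and `A_∞`, for odd `D`: here
`y = σ ^ D`, and the two linear equations have determinant `±(y - y⁻¹)`. -/
theorem exists_cycle_products_of_odd {ε y z₁ zi T : ℂ} (hy : y ≠ 0) (hd : y - y⁻¹ ≠ 0)
    (hε : ε ^ 2 = 1)
    (h : (y + y⁻¹) ^ 2 + z₁ ^ 2 + zi ^ 2 - ε * (y + y⁻¹) * zi * z₁ + T - 2 = 0) :
    ∃ A B : ℂ, A * B = ((y + y⁻¹) ^ 2 - 2 + T) / (y - y⁻¹) ^ 2 ∧ A + B = zi ∧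
      ε * y * A + ε * y⁻¹ * B = z₁ := by
  refine ⟨(ε * z₁ - y⁻¹ * zi) / (y - y⁻¹), (y * zi - ε * z₁) / (y - y⁻¹), ?_, ?_, ?_⟩
  · rw [div_mul_div_comm, ← sq]
    congr 1
    have : y⁻¹ * y = 1 := inv_mul_cancel₀ hy
    linear_combination -z₁ ^ 2 * hε - h - zi ^ 2 * this
  · rw [← add_div, div_eq_iff hd]
    ring
  · rw [mul_div_assoc', mul_div_assoc', ← add_div, div_eq_iff hd]
    linear_combination z₁ * (y - y⁻¹) * hε

/-- The products `A = Π_s` and `B = Π_t` for given values of `A_1` and `A_∞`, for even `D`: here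
`y = σ ^ D` and `τ = ε² T_N(w)`. -/
theorem exists_cycle_products_of_even {y z₁ zi τ : ℂ} (hy : y ≠ 0) (h2 : y + y⁻¹ - 2 ≠ 0)
    (h : (y + y⁻¹ + 2) * (z₁ + 2) * (zi + 2) = (y + y⁻¹ + z₁ + zi + τ + 4) ^ 2) :
    ∃ A B : ℂ, A * B = ((τ + (y + y⁻¹)) / (y + y⁻¹ - 2)) ^ 2 ∧
      A + B + (2 * τ + 4) / (y + y⁻¹ - 2) = zi ∧
      y * A + y⁻¹ * B + (2 * τ + 4) / (y + y⁻¹ - 2) = z₁ := by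
  by_cases hd : y - y⁻¹ = 0
  -- `z₀ = -2`: the equation of the variety forces the two linear equations to coincide
  · have hy2 : y ^ 2 = 1 := by
      field_simp at hd
      linear_combination hd
    have hy1 : y = -1 := by
      rcases sq_eq_sq_iff_eq_or_eq_neg.1 (hy2.trans (one_pow 2).symm) with h1 | h1
      · rw [h1] at h2; norm_num at h2
      · exact h1
    subst hy1
    obtain ⟨A, B, h3, h4⟩ := exists_add_eq_mul_eq
      (zi - (2 * τ + 4) / (-1 + (-1)⁻¹ - 2)) (((τ + (-1 + (-1)⁻¹)) / (-1 + (-1)⁻¹ - 2)) ^ 2)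
    have h5 : z₁ + zi + τ + 2 = 0 := by
      refine pow_eq_zero_iff (two_ne_zero) |>.1 ?_
      norm_num at h
      linear_combination -h
    refine ⟨A, B, h4, by rw [h3]; ring, ?_⟩
    norm_num at h3 ⊢
    linear_combination -h3 - h5
  · have hs : (y - y⁻¹) ^ 2 = (y + y⁻¹ + 2) * (y + y⁻¹ - 2) := by
      have : y⁻¹ * y = 1 := inv_mul_cancel₀ hy
      linear_combination -4 * this
    set f := (2 * τ + 4) / (y + y⁻¹ - 2) with hf
    refine ⟨((z₁ - f) - y⁻¹ * (zi - f)) / (y - y⁻¹), (y * (zi - f) - (z₁ - f)) / (y - y⁻¹),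
      ?_, ?_, ?_⟩
    · have hn : ((z₁ - f) - y⁻¹ * (zi - f)) * (y * (zi - f) - (z₁ - f)) =
          (y + y⁻¹) * (z₁ - f) * (zi - f) - (z₁ - f) ^ 2 - (zi - f) ^ 2 := by
        have : y⁻¹ * y = 1 := inv_mul_cancel₀ hy
        linear_combination -(zi - f) ^ 2 * this
      have hs0 : (y + y⁻¹ + 2) * (y + y⁻¹ - 2) ≠ 0 := hs ▸ pow_ne_zero 2 hd
      rw [div_mul_div_comm, ← sq, hn, hs]
      generalize y + y⁻¹ = z at *
      have h3 : z + 2 ≠ 0 := left_ne_zero_of_mul hs0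
      rw [hf]
      field_simp
      linear_combination (z - 2) ^ 2 * h
    · rw [← add_div, show z₁ - f - y⁻¹ * (zi - f) + (y * (zi - f) - (z₁ - f)) =
        (zi - f) * (y - y⁻¹) by ring, mul_div_cancel_right₀ _ hd, sub_add_cancel]
    · rw [mul_div_assoc', mul_div_assoc', ← add_div,
        show y * (z₁ - f - y⁻¹ * (zi - f)) + y⁻¹ * (y * (zi - f) - (z₁ - f)) =
        (z₁ - f) * (y - y⁻¹) by ring, mul_div_cancel_right₀ _ hd, sub_add_cancel]

theorem exists_isTypeZero_of_isShadowPoint {q : ℂ} (hq : IsOfFinOrder q)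
    (hκ : q ^ 2 - q⁻¹ ^ 2 ≠ 0) [NeZero (ordTwo q)] {V : Type*} [AddCommGroup V] [Module ℂ V]
    (v : Module.Basis (ZMod (ordTwo q)) ℂ V) {z₀ z₁ zi w : ℂ} (h : IsShadowPoint q z₀ z₁ zi w)
    (hg : IsGeneral q z₀) : ∃ (σ : ℂ) (s t : ZMod (ordTwo q) → ℂ)
      (ρ : Skein q →ₐ[ℂ] Module.End ℂ V), IsTypeZero q v σ w s t ρ ∧
      ρ (threadedCurve q .zero) = z₀ • (1 : Module.End ℂ V) ∧
      ρ (threadedCurve q .one) = z₁ • (1 : Module.End ℂ V) ∧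
      ρ (threadedCurve q .infty) = zi • (1 : Module.End ℂ V) := by
  have hq0 := ne_zero_of_isOfFinOrder hq
  obtain ⟨y, hy, hz⟩ := exists_add_inv_eq z₀
  obtain ⟨σ, rfl⟩ := IsAlgClosed.exists_pow_nat_eq y (NeZero.pos (ordTwo q))
  have hσ : σ ≠ 0 := by
    rintro rfl
    exact hy (zero_pow (NeZero.ne _))
  have hzz : zZero q σ = σ ^ ordTwo q + (σ ^ ordTwo q)⁻¹ := by rw [zZero, inv_pow]
  have hz' : zZero q σ = z₀ := hzz.trans hz
  subst hz'
  rcases Nat.even_or_odd (ordTwo q) with he | ho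
  · have h1 := h.2 he
    have h2 : zZero q σ - 2 ≠ 0 := by
      intro h'
      rcases hg with hg | hg
      · exact hg.1 (sub_eq_zero.1 h')
      · rw [hg.1] at h'; norm_num at h'
    obtain ⟨A, B, h3, h4, h5⟩ := exists_cycle_products_of_even hy (hzz ▸ h2) (hzz ▸ h1)
    obtain ⟨s, t, hs, ht, hr⟩ := exists_prod_eq (fun i => ratio q w (weight q σ i))
      (h3.trans ((even_special hq hκ hσ hg he w).2.trans (by rw [hzz])).symm)
    obtain ⟨ρ, hρ⟩ := exists_isTypeZero hq0 v hσ hg hr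
    have h6 := hρ.apply_threadedCurve_of_even hq hκ he
    rw [cycleProd_eq, cycleProd_eq, hs, ht, inv_pow, corr, hzz, mul_assoc, h4, h5] at h6
    exact ⟨σ, s, t, ρ, hρ, hρ.apply_threadedCurve_zero hq0, h6⟩
  · have h1 := h.1 ho
    have hd : σ ^ ordTwo q - (σ ^ ordTwo q)⁻¹ ≠ 0 := by
      intro h'
      have h2 : (zZero q σ - 2) * (zZero q σ + 2) = 0 := by
        rw [hzz]
        have : (σ ^ ordTwo q)⁻¹ * σ ^ ordTwo q = 1 := inv_mul_cancel₀ hy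
        linear_combination (σ ^ ordTwo q - (σ ^ ordTwo q)⁻¹) * h' + 4 * this
      rcases hg with hg | hg
      · rcases mul_eq_zero.1 h2 with h2 | h2
        · exact hg.1 (sub_eq_zero.1 h2)
        · exact hg.2 (eq_neg_of_add_eq_zero_left h2)
      · exact Nat.not_even_iff_odd.2 ho hg.2
    obtain ⟨A, B, h3, h4, h5⟩ := exists_cycle_products_of_odd hy hd
      (by rw [eps_of_odd ho, pow_ordTwo_sq]) (hzz ▸ h1)
    obtain ⟨s, t, hs, ht, hr⟩ := exists_prod_eq (fun i => ratio q w (weight q σ i))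
      (h3.trans ((prod_ratio_of_odd hq hσ hg ho w).trans (by rw [hzz])).symm)
    obtain ⟨ρ, hρ⟩ := exists_isTypeZero hq0 v hσ hg hr
    have h6 := hρ.apply_threadedCurve_of_odd hq hκ ho
    rw [cycleProd_eq, cycleProd_eq, hs, ht, inv_pow, h4, h5] at h6
    exact ⟨σ, s, t, ρ, hρ, hρ.apply_threadedCurve_zero hq0, h6⟩

/-! ### The skein algebra is finite over its center -/

section monomials

variable {A : Type*} [Ring A] [Algebra ℂ A]

/-- The span of the ordered monomials `aⁱ bʲ cᵏ` of degree at most `d`. -/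
def monoSpan (a b c : A) (d : ℕ) : Submodule ℂ A :=
  Submodule.span ℂ {x | ∃ i j k : ℕ, i + j + k ≤ d ∧ a ^ i * b ^ j * c ^ k = x}

variable {q : ℂ} {a b c : A}

theorem monoSpan_mono {d e : ℕ} (h : d ≤ e) : monoSpan a b c d ≤ monoSpan a b c e :=
  Submodule.span_mono fun _ ⟨i, j, k, hd, hx⟩ => ⟨i, j, k, hd.trans h, hx⟩

theorem mono_mem_monoSpan {i j k d : ℕ} (h : i + j + k ≤ d) :
    a ^ i * b ^ j * c ^ k ∈ monoSpan a b c d :=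
  Submodule.subset_span ⟨i, j, k, h, rfl⟩

theorem mul_mem_monoSpan {x : A} {d : ℕ}
    (h : ∀ i j k : ℕ, i + j + k ≤ d → x * (a ^ i * b ^ j * c ^ k) ∈ monoSpan a b c (d + 1))
    {y : A} (hy : y ∈ monoSpan a b c d) : x * y ∈ monoSpan a b c (d + 1) := by
  induction hy using Submodule.span_induction with
  | mem y hy =>
    obtain ⟨i, j, k, hd, rfl⟩ := hy
    exact h i j k hd
  | zero => rw [mul_zero]; exact zero_mem _
  | add y z _ _ hy hz => rw [mul_add]; exact add_mem hy hz
  | smul r y _ hy => rw [mul_smul_comm]; exact Submodule.smul_mem _ _ hy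

theorem left_mul_mem_monoSpan {y : A} {d : ℕ} (hy : y ∈ monoSpan a b c d) :
    a * y ∈ monoSpan a b c (d + 1) := by
  refine mul_mem_monoSpan (fun i j k h => ?_) hy
  rw [← mul_assoc, ← mul_assoc, ← pow_succ']
  exact mono_mem_monoSpan (by omega)

/-- Left multiplication by `b` or `c` raises the degree of an ordered monomial by at most one. When
the factor is moved to its place, each exchange of two generators costs a power of `q` and creates a
term of lower degree. -/
theorem IsSkeinTriple.mul_mono_mem (h : IsSkeinTriple q a b c) (hq : q ≠ 0) (e i j k : ℕ)
    (hd : i + j + k = e) : b * (a ^ i * b ^ j * c ^ k) ∈ monoSpan a b c (e + 1) ∧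
      c * (a ^ i * b ^ j * c ^ k) ∈ monoSpan a b c (e + 1) := by
  induction e using Nat.strong_induction_on generalizing i j k with
  | _ e ih =>
  have hb : ∀ i j k : ℕ, i + j + k = e → b * (a ^ i * b ^ j * c ^ k) ∈ monoSpan a b c (e + 1) := by
    intro i j k hd
    cases i with
    | zero =>
      have : b * (a ^ 0 * b ^ j * c ^ k) = a ^ 0 * b ^ (j + 1) * c ^ k := by
        rw [pow_zero, one_mul, one_mul, ← mul_assoc, pow_succ']
      rw [this]
      exact mono_mem_monoSpan (by omega)
    | succ i =>
      obtain ⟨e, rfl⟩ : ∃ e', e = e' + 1 := ⟨i + j + k, by omega⟩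
      obtain ⟨h1, h2⟩ := ih e (by omega) i j k (by omega)
      have : b * (a ^ (i + 1) * b ^ j * c ^ k) = q ^ 2 • (a * (b * (a ^ i * b ^ j * c ^ k))) -
          (q * (q ^ 2 - q⁻¹ ^ 2)) • (c * (a ^ i * b ^ j * c ^ k)) := by
        rw [pow_succ', mul_assoc a, mul_assoc a, ← mul_assoc b a, h.ba_eq hq, sub_mul,
          smul_mul_assoc, smul_mul_assoc, mul_assoc a b]
      rw [this]
      exact sub_mem (Submodule.smul_mem _ _ (left_mul_mem_monoSpan h1))
        (Submodule.smul_mem _ _ (monoSpan_mono (by omega) h2))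
  refine ⟨hb i j k hd, ?_⟩
  cases i with
  | zero =>
    cases j with
    | zero =>
      have : c * (a ^ 0 * b ^ 0 * c ^ k) = a ^ 0 * b ^ 0 * c ^ (k + 1) := by
        simp [pow_succ']
      rw [this]
      exact mono_mem_monoSpan (by omega)
    | succ j =>
      obtain ⟨e, rfl⟩ : ∃ e', e = e' + 1 := ⟨j + k, by omega⟩
      obtain ⟨h1, h2⟩ := ih e (by omega) 0 j k (by omega)
      have : c * (a ^ 0 * b ^ (j + 1) * c ^ k) = q ^ 2 • (b * (c * (a ^ 0 * b ^ j * c ^ k))) -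
          (q * (q ^ 2 - q⁻¹ ^ 2)) • (a * (a ^ 0 * b ^ j * c ^ k)) := by
        rw [pow_zero, one_mul, one_mul, pow_succ', mul_assoc b, ← mul_assoc c b,
          h.rotate.ba_eq hq, sub_mul, smul_mul_assoc, smul_mul_assoc, mul_assoc b c]
      rw [this]
      refine sub_mem (Submodule.smul_mem _ _ (mul_mem_monoSpan (fun i j k hd => ?_) h2))
        (Submodule.smul_mem _ _ (monoSpan_mono (by omega)
          (left_mul_mem_monoSpan (mono_mem_monoSpan (d := e) (by omega)))))
      rcases Nat.lt_or_ge (i + j + k) (e + 1) with hlt | hge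
      · exact monoSpan_mono (by omega) (ih (i + j + k) hlt i j k rfl).1
      · exact hb i j k (by omega)
  | succ i =>
    obtain ⟨e, rfl⟩ : ∃ e', e = e' + 1 := ⟨i + j + k, by omega⟩
    obtain ⟨h1, h2⟩ := ih e (by omega) i j k (by omega)
    have : c * (a ^ (i + 1) * b ^ j * c ^ k) = q⁻¹ ^ 2 • (a * (c * (a ^ i * b ^ j * c ^ k))) +
        (q⁻¹ * (q ^ 2 - q⁻¹ ^ 2)) • (b * (a ^ i * b ^ j * c ^ k)) := by
      rw [pow_succ', mul_assoc a, mul_assoc a, ← mul_assoc c a, h.rotate.rotate.ab_eq hq, add_mul,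
        smul_mul_assoc, smul_mul_assoc, mul_assoc a c]
    rw [this]
    exact add_mem (Submodule.smul_mem _ _ (left_mul_mem_monoSpan h2))
      (Submodule.smul_mem _ _ (monoSpan_mono (by omega) h1))

end monomials

/-- The ordered monomials span the skein algebra. -/
theorem exists_mem_monoSpan {q : ℂ} (hq : q ≠ 0) (x : Skein q) :
    ∃ d, x ∈ monoSpan (curve q .zero) (curve q .infty) (curve q .one) d := by
  have h := isSkeinTriple_curve q
  have hmul : ∀ x : Skein q, ∀ d,
      ∀ y ∈ monoSpan (curve q .zero) (curve q .infty) (curve q .one) d,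
      ∃ e, x * y ∈ monoSpan (curve q .zero) (curve q .infty) (curve q .one) e := by
    intro x
    induction x using skein_induction with
    | hc m =>
      intro d y hy
      refine ⟨d + 1, ?_⟩
      cases m with
      | zero => exact left_mul_mem_monoSpan hy
      | infty =>
        exact mul_mem_monoSpan (fun i j k hd => monoSpan_mono (by omega)
          (h.mul_mono_mem hq _ i j k rfl).1) hy
      | one =>
        exact mul_mem_monoSpan (fun i j k hd => monoSpan_mono (by omega)
          (h.mul_mono_mem hq _ i j k rfl).2) hy
    | h1 z =>
      intro d y hy
      rw [← Algebra.smul_def]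
      exact ⟨d, Submodule.smul_mem _ _ hy⟩
    | hadd x x' hx hx' =>
      intro d y hy
      obtain ⟨e, he⟩ := hx d y hy
      obtain ⟨e', he'⟩ := hx' d y hy
      rw [add_mul]
      exact ⟨max e e', add_mem (monoSpan_mono (le_max_left _ _) he)
        (monoSpan_mono (le_max_right _ _) he')⟩
    | hmul x x' hx hx' =>
      intro d y hy
      obtain ⟨e, he⟩ := hx' d y hy
      rw [mul_assoc]
      exact hx e _ he
  have := hmul x 0 1 (by simpa using mono_mem_monoSpan (i := 0) (j := 0) (k := 0) (d := 0) le_rfl)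
  rwa [mul_one] at this

theorem natDegree_cheb_le (k : ℕ) : (cheb k).natDegree ≤ k := by
  induction k using Nat.twoStepInduction with
  | zero => simp [cheb]
  | one => simp [cheb]
  | more k h1 h2 =>
    have e : cheb (k + 2) = X * cheb (k + 1) - cheb k := by
      simp only [cheb]
      push_cast
      rw [Chebyshev.C_add_two]
    rw [e]
    refine (natDegree_sub_le _ _).trans (max_le ?_ (by omega))
    exact natDegree_mul_le.trans (by rw [natDegree_X]; omega)

theorem coeff_cheb_self (k : ℕ) : (cheb (k + 1)).coeff (k + 1) = 1 := by
  induction k with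
  | zero => simp [cheb]
  | succ k ih =>
    have e : cheb (k + 2) = X * cheb (k + 1) - cheb k := by
      simp only [cheb]
      push_cast
      rw [Chebyshev.C_add_two]
    rw [e, coeff_sub, coeff_X_mul, ih,
      coeff_eq_zero_of_natDegree_lt ((natDegree_cheb_le k).trans_lt (by omega)), sub_zero]

theorem monic_cheb_sub_C {k : ℕ} (hk : 0 < k) {R : Type*} [CommRing R] [Algebra ℂ R] (z : R) :
    ((cheb k).map (algebraMap ℂ R) - C z).Monic := by
  obtain ⟨k, rfl⟩ := Nat.exists_eq_add_of_le' hk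
  refine monic_of_natDegree_le_of_coeff_eq_one (k + 1) ?_ ?_
  · refine (natDegree_sub_le _ _).trans (max_le ?_ (by simp))
    exact natDegree_map_le.trans (natDegree_cheb_le _)
  · rw [coeff_sub, coeff_map, coeff_cheb_self, coeff_C_succ, map_one, sub_zero]

section quotient

variable {R A : Type} [CommRing R] [Ring A] [Algebra ℂ R] [Algebra ℂ A] [Algebra R A]
  [IsScalarTower ℂ R A]

theorem isIntegral_of_aeval_cheb {k : ℕ} (hk : 0 < k) {x : A} {z : R}
    (h : aeval x (cheb k) = algebraMap R A z) : IsIntegral R x := by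
  refine ⟨(cheb k).map (algebraMap ℂ R) - C z, monic_cheb_sub_C hk z, ?_⟩
  rw [eval₂_sub, eval₂_C, eval₂_map, ← IsScalarTower.algebraMap_eq ℂ R A, ← h]
  exact sub_self _

theorem finite_of_isIntegral {a b c : A} (ha : IsIntegral R a) (hb : IsIntegral R b)
    (hc : IsIntegral R c) (h : ∀ x : A, ∃ d, x ∈ monoSpan a b c d) : Module.Finite R A := by
  have hpow : ∀ (x : A) (i : ℕ), x ^ i ∈ (Algebra.adjoin R {x}).toSubmodule := fun x i =>
    pow_mem (Algebra.subset_adjoin (Set.mem_singleton x)) i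
  refine ⟨?_⟩
  have htop : (Algebra.adjoin R {a}).toSubmodule * (Algebra.adjoin R {b}).toSubmodule *
      (Algebra.adjoin R {c}).toSubmodule = ⊤ := by
    rw [eq_top_iff]
    rintro x -
    obtain ⟨d, hd⟩ := h x
    induction hd using Submodule.span_induction with
    | mem x hx =>
      obtain ⟨i, j, k, -, rfl⟩ := hx
      exact Submodule.mul_mem_mul (Submodule.mul_mem_mul (hpow a i) (hpow b j)) (hpow c k)
    | zero => exact zero_mem _
    | add x y _ _ hx hy => exact add_mem hx hy
    | smul r x _ hx => exact Submodule.smul_of_tower_mem _ r hx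
  rw [← htop]
  exact Submodule.FG.mul (Submodule.FG.mul ha.fg_adjoin_singleton hb.fg_adjoin_singleton)
    hc.fg_adjoin_singleton

/-- A character of a commutative ring `R` acting faithfully on a finite `R`-algebra `A` is the
central character of a nonzero finite dimensional representation of `A`: the quotient of `A` by the
ideal generated by the kernel of the character, which is proper by Nakayama's lemma. -/
theorem exists_rep_of_character [Module.Finite R A]
    (hinj : Function.Injective (algebraMap R A)) (χ : R →ₐ[ℂ] ℂ) :
    ∃ (M : Type) (_ : AddCommGroup M) (_ : Module ℂ M) (_ : FiniteDimensional ℂ M)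
      (_ : Nontrivial M) (π : A →ₐ[ℂ] Module.End ℂ M),
      ∀ z : R, π (algebraMap R A z) = χ z • (1 : Module.End ℂ M) := by
  let I : Submodule A A := Submodule.span A {x | ∃ z : R, χ z = 0 ∧ algebraMap R A z = x}
  have hIJ : ∀ x ∈ I, x ∈ (RingHom.ker χ • ⊤ : Submodule R A) := by
    intro x hx
    induction hx using Submodule.span_induction with
    | mem x hx =>
      obtain ⟨z, hz, rfl⟩ := hx
      rw [Algebra.algebraMap_eq_smul_one]
      exact Submodule.smul_mem_smul hz trivial
    | zero => exact zero_mem _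
    | add x y _ _ hx hy => exact add_mem hx hy
    | smul s x _ hx =>
      refine Submodule.smul_induction_on hx (fun z hz y _ => ?_) fun x y hx hy => ?_
      · rw [smul_eq_mul, mul_smul_comm]
        exact Submodule.smul_mem_smul hz trivial
      · rw [smul_add]
        exact add_mem hx hy
  have hne : I ≠ ⊤ := by
    intro htop
    have hJ : (⊤ : Submodule R A) ≤ RingHom.ker χ • ⊤ := fun x _ => hIJ x (htop ▸ trivial)
    obtain ⟨r, hr, h0⟩ := Submodule.exists_sub_one_mem_and_smul_eq_zero_of_fg_of_le_smul _ _
      Module.Finite.fg_top hJ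
    have h1 : r = 0 := by
      have := h0 1 trivial
      rw [← Algebra.algebraMap_eq_smul_one] at this
      exact hinj (this.trans (map_zero _).symm)
    rw [RingHom.mem_ker, h1, zero_sub, map_neg, map_one] at hr
    norm_num at hr
  have hact : ∀ (z : R) (x : A), (Submodule.Quotient.mk (algebraMap R A z * x) : A ⧸ I) =
      χ z • Submodule.Quotient.mk x := by
    intro z x
    rw [← Submodule.Quotient.mk_smul, Submodule.Quotient.eq]
    have e : algebraMap R A z * x - χ z • x =
        x • algebraMap R A (z - algebraMap ℂ R (χ z)) := by
      rw [smul_eq_mul, ← Algebra.commutes, map_sub, sub_mul, ← IsScalarTower.algebraMap_apply,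
        Algebra.smul_def (χ z)]
    rw [e]
    refine I.smul_mem x (Submodule.subset_span ⟨_, ?_, rfl⟩)
    rw [map_sub, AlgHom.commutes, Algebra.algebraMap_self, RingHom.id_apply, sub_self]
  have hfin : FiniteDimensional ℂ (A ⧸ I) := by
    obtain ⟨F, hF⟩ := Module.Finite.fg_top (R := R) (M := A)
    classical
    refine ⟨⟨F.image Submodule.Quotient.mk, ?_⟩⟩
    rw [eq_top_iff]
    rintro y -
    obtain ⟨x, rfl⟩ := Submodule.Quotient.mk_surjective I y
    have hx : x ∈ Submodule.span R (F : Set A) := hF ▸ trivial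
    induction hx using Submodule.span_induction with
    | mem x hx => exact Submodule.subset_span (by simpa using ⟨x, hx, rfl⟩)
    | zero => exact zero_mem _
    | add x y _ _ hx hy => exact add_mem hx hy
    | smul z x _ hx =>
      rw [Algebra.smul_def, hact]
      exact Submodule.smul_mem _ _ hx
  refine ⟨A ⧸ I, inferInstance, inferInstance, hfin,
    Submodule.Quotient.nontrivial_iff.2 hne, Algebra.lsmul ℂ ℂ (A ⧸ I), fun z => ?_⟩
  refine LinearMap.ext fun y => ?_
  obtain ⟨x, rfl⟩ := Submodule.Quotient.mk_surjective I y
  exact hact z x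

end quotient

/-- A version of `exists_rep_of_character` for a ring `R` of central elements, over which `a`, `b`, `c`
are integral because `T_k` maps them to `R`. -/
theorem exists_rep_of_central_subring {R A : Type} [CommRing R] [Ring A] [Algebra ℂ R]
    [Algebra ℂ A] (f : R →ₐ[ℂ] A) (hf : Function.Injective f)
    (hcomm : ∀ z x, f z * x = x * f z) {k : ℕ} (hk : 0 < k) {a b c : A}
    (ha : ∃ z, aeval a (cheb k) = f z) (hb : ∃ z, aeval b (cheb k) = f z)
    (hc : ∃ z, aeval c (cheb k) = f z) (h : ∀ x : A, ∃ d, x ∈ monoSpan a b c d)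
    (χ : R →ₐ[ℂ] ℂ) :
    ∃ (M : Type) (_ : AddCommGroup M) (_ : Module ℂ M) (_ : FiniteDimensional ℂ M)
      (_ : Nontrivial M) (π : A →ₐ[ℂ] Module.End ℂ M),
      ∀ z : R, π (f z) = χ z • (1 : Module.End ℂ M) := by
  let _ : Algebra R A := f.toRingHom.toAlgebra' hcomm
  have : IsScalarTower ℂ R A := IsScalarTower.of_algebraMap_eq fun z => (f.commutes z).symm
  obtain ⟨za, ha⟩ := ha
  obtain ⟨zb, hb⟩ := hb
  obtain ⟨zc, hc⟩ := hc
  have : Module.Finite R A :=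
    finite_of_isIntegral (isIntegral_of_aeval_cheb hk ha) (isIntegral_of_aeval_cheb hk hb)
      (isIntegral_of_aeval_cheb hk hc) h
  exact exists_rep_of_character hf χ

/-- Every character of the center of the skein algebra is the central character of a nonzero finite
dimensional representation. -/
theorem exists_rep_of_center_character {q : ℂ} (hq : IsOfFinOrder q) (hκ : q ^ 2 - q⁻¹ ^ 2 ≠ 0)
    (χ : Center q →ₐ[ℂ] ℂ) : ∃ (M : Type) (_ : AddCommGroup M) (_ : Module ℂ M)
      (_ : FiniteDimensional ℂ M) (_ : Nontrivial M) (π : Skein q →ₐ[ℂ] Module.End ℂ M),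
      ∀ z : Center q, π z = χ z • (1 : Module.End ℂ M) := by
  have hq0 := ne_zero_of_isOfFinOrder hq
  have hz : ∀ m, ∃ z : Center q, aeval (curve q m) (cheb (ordTwo q)) = (Center q).val z := fun m =>
    ⟨⟨threadedCurve q m, threadedCurve_mem_center hq0 hκ m⟩, rfl⟩
  exact exists_rep_of_central_subring (R := Center q) (A := Skein q) (Center q).val
    Subtype.val_injective (fun z x => (Subalgebra.mem_center_iff.1 z.2 x).symm) (ordTwo_pos hq)
    (hz .zero) (hz .infty) (hz .one) (exists_mem_monoSpan hq0) χ

/-! ### Ladder operators -/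

/-- Inversion of `x` reverses the direction of the cycle. -/
theorem ratio_inv {q : ℂ} (hq : q ≠ 0) (w : ℂ) {x : ℂ} (hx : x ≠ 0) :
    ratio q w x⁻¹ = ratio q w (q⁻¹ ^ 2 * x) := by
  rw [ratio, ratio]
  have e1 : (x⁻¹ - x⁻¹⁻¹) * (q ^ 2 * x⁻¹ - q⁻¹ ^ 2 * x⁻¹⁻¹) =
      (q⁻¹ ^ 2 * x - (q⁻¹ ^ 2 * x)⁻¹) * (q ^ 2 * (q⁻¹ ^ 2 * x) - q⁻¹ ^ 2 * (q⁻¹ ^ 2 * x)⁻¹) := by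
    field_simp
    ring
  rw [e1]
  congr 1
  field_simp
  ring

section ladder

variable {M : Type*} [AddCommGroup M] [Module ℂ M] {q w : ℂ} {a b c : Module.End ℂ M}

/-- The ladder operator: it maps the eigenspace of `a` for `x + x⁻¹` to the one for
`q² x + q⁻² x⁻¹`. Since the former depends on `x` only up to inversion, the operator at `x⁻¹`
goes in the opposite direction. -/
def ladder (q : ℂ) (b c : Module.End ℂ M) (x : ℂ) : Module.End ℂ M :=
  (q * (x - x⁻¹))⁻¹ • (c - (q * x⁻¹) • b)

theorem ladder_apply (x : ℂ) (u : M) :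
    ladder q b c x u = (q * (x - x⁻¹))⁻¹ • (c u - (q * x⁻¹) • b u) := rfl

theorem apply_ladder (h : IsSkeinTriple q a b c) (hq : q ≠ 0) {x : ℂ} (hx : x ≠ 0) {u : M}
    (hu : a u = (x + x⁻¹) • u) :
    a (ladder q b c x u) = (q ^ 2 * x + (q ^ 2 * x)⁻¹) • ladder q b c x u := by
  have h1 := LinearMap.congr_fun (h.ab_eq hq) u
  have h2 := LinearMap.congr_fun (h.rotate.rotate.ba_eq hq) u
  simp only [Module.End.mul_apply, LinearMap.add_apply, LinearMap.sub_apply, LinearMap.smul_apply,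
    hu, map_smul] at h1 h2
  rw [ladder_apply, map_smul, map_sub, map_smul, h1, h2, smul_comm _ (q * (x - x⁻¹))⁻¹]
  congr 1
  match_scalars
  · field_simp
    ring
  · field_simp
    ring

theorem infty_apply_eq (hq : q ≠ 0) {x : ℂ} (hx : x - x⁻¹ ≠ 0) (u : M) :
    b u = ladder q b c x u + ladder q b c x⁻¹ u := by
  rw [ladder_apply, ladder_apply, inv_inv]
  generalize x⁻¹ = y at *
  have h1 : y - x ≠ 0 := by rwa [← neg_sub, neg_ne_zero]
  match_scalars
  · field_simp
    grind
  · grind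

theorem one_apply_eq (hq : q ≠ 0) {x : ℂ} (hx0 : x ≠ 0) (hx : x - x⁻¹ ≠ 0) (u : M) :
    c u = (q * x) • ladder q b c x u + (q * x⁻¹) • ladder q b c x⁻¹ u := by
  rw [ladder_apply, ladder_apply, inv_inv]
  generalize x⁻¹ = y at *
  have h1 : y - x ≠ 0 := by rwa [← neg_sub, neg_ne_zero]
  match_scalars
  · grind
  · grind

/-- Going up and down again multiplies by the ratio, as it does in a type-`0` representation. -/
theorem ladder_ladder (h : IsSkeinTriple q a b c) (hq : q ≠ 0) (hp : peri q a b c = w • 1) {x : ℂ}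
    (hx0 : x ≠ 0) (hx : x - x⁻¹ ≠ 0) (hx' : q ^ 2 * x - (q ^ 2 * x)⁻¹ ≠ 0) {u : M}
    (hu : a u = (x + x⁻¹) • u) :
    ladder q b c (q ^ 2 * x)⁻¹ (ladder q b c x u) = ratio q w x • u := by
  have h1 := LinearMap.congr_fun (h.rotate.ba_eq hq) u
  have h2 := LinearMap.congr_fun (h.peri_rotate hq |>.trans hp) u
  simp only [peri, Module.End.mul_apply, LinearMap.add_apply, LinearMap.sub_apply,
    LinearMap.smul_apply, hu, map_smul, Module.algebraMap_end_apply, sq b, sq c, sq a,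
    Module.End.one_apply] at h1 h2
  rw [ladder_apply, ladder_apply, map_smul, map_smul, map_sub, map_sub, map_smul, map_smul, h1,
    smul_comm _ (q * (x - x⁻¹))⁻¹, ← smul_sub, smul_smul, inv_inv]
  have key : c (c u) - (q * x⁻¹) • (q ^ 2 • b (c u) - (q * (q ^ 2 - q⁻¹ ^ 2)) • (x + x⁻¹) • u) -
      (q * (q ^ 2 * x)) • (b (c u) - (q * x⁻¹) • b (b u)) =
      (-q ^ 2 * (w + q ^ 2 * x ^ 2 + q⁻¹ ^ 2 * x⁻¹ ^ 2)) • u := by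
    rw [← sub_eq_zero] at h2 ⊢
    -- the difference of the two sides is `-q²` times the peripheral relation
    refine Eq.trans ?_ ((congrArg ((-q ^ 2) • ·) h2).trans (smul_zero _))
    match_scalars <;> field_simp <;> ring
  rw [key, smul_smul, ratio]
  congr 1
  have e : q ^ 2 * x - q⁻¹ ^ 2 * x⁻¹ = q ^ 2 * x - (q ^ 2 * x)⁻¹ := by rw [mul_inv, inv_pow]
  rw [e, ← neg_sub (q ^ 2 * x)]
  generalize q ^ 2 * x - (q ^ 2 * x)⁻¹ = d' at *
  generalize x - x⁻¹ = d at *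
  generalize w + q ^ 2 * x ^ 2 + q⁻¹ ^ 2 * x⁻¹ ^ 2 = r
  field_simp

/-- The composite of the first `k` ladder operators starting at `x`. -/
def ladderPow (q : ℂ) (b c : Module.End ℂ M) (x : ℂ) : ℕ → Module.End ℂ M
  | 0 => 1
  | k + 1 => ladder q b c ((q ^ 2) ^ k * x) * ladderPow q b c x k

theorem ladderPow_succ_apply (x : ℂ) (k : ℕ) (u : M) : ladderPow q b c x (k + 1) u =
    ladder q b c ((q ^ 2) ^ k * x) (ladderPow q b c x k u) := rfl

theorem apply_ladderPow (h : IsSkeinTriple q a b c) (hq : q ≠ 0) {x : ℂ} (hx : x ≠ 0) {u : M}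
    (hu : a u = (x + x⁻¹) • u) (k : ℕ) : a (ladderPow q b c x k u) =
      ((q ^ 2) ^ k * x + ((q ^ 2) ^ k * x)⁻¹) • ladderPow q b c x k u := by
  induction k with
  | zero => simpa [ladderPow] using hu
  | succ k ih =>
    rw [ladderPow_succ_apply, apply_ladder h hq (mul_ne_zero (pow_ne_zero _ (pow_ne_zero _ hq)) hx)
      ih, pow_succ' (q ^ 2), mul_assoc]

theorem exists_eigenvector_mem [FiniteDimensional ℂ M] (f : Module.End ℂ M) (W : Submodule ℂ M)
    (hf : ∀ u ∈ W, f u ∈ W) {u₀ : M} (h0 : u₀ ∈ W) (h0' : u₀ ≠ 0) :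
    ∃ (A : ℂ) (u : M), u ∈ W ∧ u ≠ 0 ∧ f u = A • u := by
  have : Nontrivial W := ⟨⟨⟨u₀, h0⟩, 0, fun h => h0' (congrArg Subtype.val h)⟩⟩
  obtain ⟨A, hA⟩ := Module.End.exists_eigenvalue (f.restrict hf)
  obtain ⟨u, hu⟩ := hA.exists_hasEigenvector
  exact ⟨A, u, u.2, fun h => hu.2 (Subtype.ext h), congrArg Subtype.val hu.apply_eq_smul⟩

/-- In a nonzero finite dimensional representation there is an eigenvector `u` of `a` which is also an
eigenvector of the composite of all `D` ladder operators around the cycle, and for which the downward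
ladder operator sends `u` to a multiple of the last vector of the cycle. There are two cases: either
some downward ladder operator has a kernel in an eigenspace, and `u` is taken in this kernel, which
is stable under the full turn, or all ladder operators are injective on the eigenspaces, and then
the eigenvalue `A` of the full turn is nonzero, so that going down from `u` is determined by going
down from `A u`. -/
theorem exists_cyclic_vector [FiniteDimensional ℂ M] [Nontrivial M] [NeZero (ordTwo q)]
    (h : IsSkeinTriple q a b c) (hq : q ≠ 0) (hp : peri q a b c = w • 1) {z₀ : ℂ}
    (hz : aeval a (cheb (ordTwo q)) = z₀ • (1 : Module.End ℂ M)) (hg : IsGeneral q z₀) :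
    ∃ (σ : ℂ) (u : M) (A T : ℂ), σ ≠ 0 ∧ zZero q σ = z₀ ∧ u ≠ 0 ∧ a u = (σ + σ⁻¹) • u ∧
      ladderPow q b c σ (ordTwo q) u = A • u ∧
      ladder q b c σ⁻¹ u = T • ladderPow q b c σ (ordTwo q - 1) u ∧
      A * T = ratio q w ((q ^ 2) ^ (ordTwo q - 1) * σ) := by
  have hpos := NeZero.pos (ordTwo q)
  have hlast : ∀ x : ℂ, q ^ 2 * ((q ^ 2) ^ (ordTwo q - 1) * x) = x := fun x => by
    rw [← mul_assoc, ← pow_succ', Nat.sub_add_cancel hpos, pow_ordTwo, one_mul]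
  have hn1 : ordTwo q = ordTwo q - 1 + 1 := (Nat.sub_add_cancel hpos).symm
  -- going down after a full turn
  have hdown : ∀ x : ℂ, x ≠ 0 → zZero q x = z₀ → ∀ u : M, a u = (x + x⁻¹) • u →
      ladder q b c x⁻¹ (ladderPow q b c x (ordTwo q) u) =
        ratio q w ((q ^ 2) ^ (ordTwo q - 1) * x) • ladderPow q b c x (ordTwo q - 1) u := by
    intro x hx hzx u hu
    have hgs := isGeomSeq_weight hq hx (hzx ▸ hg)
    have e1 : (q ^ 2) ^ (ordTwo q - 1) * x =
        weight q x ((ordTwo q - 1 : ℕ) : ZMod (ordTwo q)) := by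
      rw [weight_eq, ZMod.val_cast_of_lt (by omega)]
    have := ladder_ladder h hq hp (x := (q ^ 2) ^ (ordTwo q - 1) * x)
      (by rw [e1]; exact hgs.ne_zero _) (by rw [e1]; exact hgs.sub_inv_ne_zero _)
      (by rw [hlast, ← weight_zero q x]; exact hgs.sub_inv_ne_zero 0)
      (apply_ladderPow h hq hx hu (ordTwo q - 1))
    rw [hlast] at this
    rw [← this]
    conv_lhs => rw [hn1, ladderPow_succ_apply]
  have hcycle : ∀ x : ℂ, x ≠ 0 → ∀ u : M, a u = (x + x⁻¹) • u →
      a (ladderPow q b c x (ordTwo q) u) = (x + x⁻¹) • ladderPow q b c x (ordTwo q) u := by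
    intro x hx u hu
    have := apply_ladderPow h hq hx hu (ordTwo q)
    rwa [pow_ordTwo, one_mul] at this
  by_cases hk : ∃ (x : ℂ) (u : M), x ≠ 0 ∧ zZero q x = z₀ ∧ u ≠ 0 ∧ a u = (x + x⁻¹) • u ∧
      ladder q b c x⁻¹ u = 0
  · obtain ⟨x, u₀, hx, hzx, hu0, hau0, hlu0⟩ := hk
    have hgs := isGeomSeq_weight hq hx (hzx ▸ hg)
    have hr : ratio q w ((q ^ 2) ^ (ordTwo q - 1) * x) = 0 := by
      have e0 : (q ^ 2) ^ (ordTwo q - 1) * x = q⁻¹ ^ 2 * x := by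
        have := hlast x
        have hq2 : q ^ 2 ≠ 0 := pow_ne_zero 2 hq
        apply mul_left_cancel₀ hq2
        rw [this]
        field_simp
      rw [e0, ← ratio_inv hq w hx]
      have h1 : x⁻¹ - x⁻¹⁻¹ ≠ 0 := by
        have := hgs.sub_inv_ne_zero 0
        rw [weight_zero] at this
        rw [inv_inv, ← neg_sub]
        exact neg_ne_zero.2 this
      have h2 : q ^ 2 * x⁻¹ - (q ^ 2 * x⁻¹)⁻¹ ≠ 0 := by
        have := hgs.sub_inv_ne_zero (0 - 1)
        rw [hgs.pred hq, weight_zero] at this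
        rw [← neg_sub]
        refine neg_ne_zero.2 ?_
        convert this using 2
        · rw [mul_inv, inv_inv, inv_pow]
        · rw [mul_inv, inv_pow, inv_inv]
      have := ladder_ladder h hq hp (inv_ne_zero hx) h1 h2 (u := u₀)
        (by rw [hau0, inv_inv, add_comm])
      rw [hlu0, map_zero] at this
      exact (smul_eq_zero.1 this.symm).resolve_right hu0
    -- since the last ratio vanishes, the full turn preserves the kernel
    obtain ⟨A, u, huW, hu, hA⟩ := exists_eigenvector_mem (ladderPow q b c x (ordTwo q))
      (Module.End.eigenspace a (x + x⁻¹) ⊓ LinearMap.ker (ladder q b c x⁻¹))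
      (fun u hu => by
        have hau : a u = (x + x⁻¹) • u := Module.End.mem_eigenspace_iff.1 hu.1
        refine ⟨?_, ?_⟩
        · exact Module.End.mem_eigenspace_iff.2 (hcycle x hx u hau)
        · change ladder q b c x⁻¹ _ = 0
          rw [hdown x hx hzx u hau, hr, zero_smul])
      ⟨Module.End.mem_eigenspace_iff.2 hau0, hlu0⟩ hu0
    refine ⟨x, u, A, 0, hx, hzx, hu, Module.End.mem_eigenspace_iff.1 huW.1, hA, ?_,
      by rw [hr, mul_zero]⟩
    rw [zero_smul]
    exact huW.2
  -- `ladder x⁻¹` is both a downward operator at `x` and the upward operator at `x⁻¹`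
  · have hinj : ∀ (x : ℂ) (u : M), x ≠ 0 → zZero q x = z₀ → u ≠ 0 → a u = (x + x⁻¹) • u →
        ladder q b c x u ≠ 0 := by
      intro x u hx hzx hu hau h0
      refine hk ⟨x⁻¹, u, inv_ne_zero hx, ?_, hu, ?_, by rwa [inv_inv]⟩
      · rw [← hzx, zZero, zZero, inv_inv, add_comm]
      · rw [hau, inv_inv, add_comm]
    obtain ⟨l, hl⟩ := Module.End.exists_eigenvalue a
    obtain ⟨u₀, hu0⟩ := hl.exists_hasEigenvector
    obtain ⟨σ, hσ, rfl⟩ := exists_add_inv_eq l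
    have hzσ : zZero q σ = z₀ := by
      have h1 := Module.End.aeval_apply_of_hasEigenvector (p := cheb (ordTwo q)) hu0
      rw [hz, eval_cheb hσ] at h1
      exact (smul_left_injective ℂ hu0.2 h1).symm
    obtain ⟨A, u, huW, hu, hA⟩ := exists_eigenvector_mem (ladderPow q b c σ (ordTwo q))
      (Module.End.eigenspace a (σ + σ⁻¹))
      (fun u hu => Module.End.mem_eigenspace_iff.2
        (hcycle σ hσ u (Module.End.mem_eigenspace_iff.1 hu)))
      hu0.1 hu0.2
    have hau : a u = (σ + σ⁻¹) • u := Module.End.mem_eigenspace_iff.1 huW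
    have hne : ∀ k, ladderPow q b c σ k u ≠ 0 := by
      intro k
      induction k with
      | zero => exact hu
      | succ k ih =>
        refine hinj _ _ (mul_ne_zero (pow_ne_zero _ (pow_ne_zero _ hq)) hσ) ?_ ih
          (apply_ladderPow h hq hσ hau k)
        rw [← hzσ, zZero, zZero, inv_pow, inv_pow, mul_pow, pow_right_comm, pow_ordTwo, one_pow,
          one_mul]
    have hA0 : A ≠ 0 := by
      rintro rfl
      exact hne (ordTwo q) (by rw [hA, zero_smul])
    refine ⟨σ, u, A, A⁻¹ * ratio q w ((q ^ 2) ^ (ordTwo q - 1) * σ), hσ, hzσ, hu, hau, hA, ?_,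
      mul_inv_cancel_left₀ hA0 _⟩
    have := hdown σ hσ hzσ u hau
    rw [hA, map_smul] at this
    rw [mul_smul, ← this, smul_smul, inv_mul_cancel₀ hA0, one_smul]

end ladder

/-! ### Type-`0` representations with a given central character -/

/-- A representation in which `p` and `A_0` act as scalars admits a nonzero homomorphism from a
type-`0` representation, with all `s_i` equal to `1` but the last: it sends `v_i` to the `i`-th vector
of the cycle through the vector provided by `exists_cyclic_vector`. -/
theorem exists_intertwiner {q : ℂ} (hq : q ≠ 0) [NeZero (ordTwo q)] {V M : Type*}
    [AddCommGroup V] [Module ℂ V] [AddCommGroup M] [Module ℂ M] [FiniteDimensional ℂ M]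
    [Nontrivial M] (v : Module.Basis (ZMod (ordTwo q)) ℂ V) (π : Skein q →ₐ[ℂ] Module.End ℂ M)
    {w z₀ : ℂ} (hp : π (peripheral q) = w • 1) (hz : π (threadedCurve q .zero) = z₀ • 1)
    (hg : IsGeneral q z₀) :
    ∃ (σ : ℂ) (s t : ZMod (ordTwo q) → ℂ) (ρ : Skein q →ₐ[ℂ] Module.End ℂ V) (φ : V →ₗ[ℂ] M),
      IsTypeZero q v σ w s t ρ ∧ φ (v 0) ≠ 0 ∧ ∀ x y, φ (ρ x y) = π x (φ y) := by
  have h := (isSkeinTriple_curve q).map π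
  have hp' : peri q (π (curve q .zero)) (π (curve q .infty)) (π (curve q .one)) = w • 1 := by
    rw [← hp, peripheral_eq]
    simp [peri, map_smul]
  rw [map_threadedCurve] at hz
  obtain ⟨σ, u, A, T, hσ, hzσ, hu, hau, hA, hT, hAT⟩ := exists_cyclic_vector h hq hp' hz hg
  subst hzσ
  set b := π (curve q .infty)
  set c := π (curve q .one)
  have hx := isGeomSeq_weight hq hσ hg
  let s : ZMod (ordTwo q) → ℂ := fun i => if i.val + 1 = ordTwo q then A else 1
  let t : ZMod (ordTwo q) → ℂ := fun i =>
    if i.val + 1 = ordTwo q then T else ratio q w (weight q σ i)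
  have hst : ∀ i, s i * t i = ratio q w (weight q σ i) := by
    intro i
    by_cases hi : i.val + 1 = ordTwo q
    · simp only [s, t, if_pos hi, hAT, weight_eq, ← Nat.eq_sub_of_add_eq hi]
    · simp only [s, t, if_neg hi, one_mul]
  obtain ⟨ρ, hρ⟩ := exists_isTypeZero hq v hσ hg hst
  obtain ⟨-, -, -, h0, h1, h2⟩ := (isTypeZero_iff hq).1 hρ
  let e : ZMod (ordTwo q) → M := fun i => ladderPow q b c σ i.val u
  have hae : ∀ i, π (curve q .zero) (e i) = (weight q σ i + (weight q σ i)⁻¹) • e i := fun i => by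
    rw [weight_eq]
    exact apply_ladderPow h hq hσ hau i.val
  have hval : ∀ i : ZMod (ordTwo q), i.val + 1 = ordTwo q → i + 1 = 0 := fun i hi => by
    rw [← ZMod.natCast_zmod_val i, ← Nat.cast_one, ← Nat.cast_add, hi, ZMod.natCast_self]
  have hval' : ∀ i : ZMod (ordTwo q), i.val + 1 ≠ ordTwo q → (i + 1).val = i.val + 1 := by
    intro i hi
    have := ZMod.val_lt i
    conv_lhs => rw [← ZMod.natCast_zmod_val i, ← Nat.cast_one, ← Nat.cast_add,
      ZMod.val_cast_of_lt (by omega)]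
  have he0 : e 0 = u := by simp [e, ladderPow]
  have hup : ∀ i, ladder q b c (weight q σ i) (e i) = s i • e (i + 1) := by
    intro i
    have e1 : ladder q b c (weight q σ i) (e i) = ladderPow q b c σ (i.val + 1) u := by
      rw [ladderPow_succ_apply, weight_eq]
    by_cases hi : i.val + 1 = ordTwo q
    · simp only [s, if_pos hi]
      rw [e1, hi, hA, hval i hi, he0]
    · simp only [s, if_neg hi, one_smul]
      rw [e1, ← hval' i hi]
  have hdown : ∀ i, ladder q b c (weight q σ (i + 1))⁻¹ (e (i + 1)) = t i • e i := by
    intro i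
    by_cases hi : i.val + 1 = ordTwo q
    · simp only [t, if_pos hi]
      rw [hval i hi, weight_zero, he0, hT, ← Nat.eq_sub_of_add_eq hi]
    · have e1 := hup i
      simp only [s, if_neg hi, one_smul] at e1
      simp only [t, if_neg hi]
      rw [← e1, hx.succ]
      exact ladder_ladder h hq hp' (hx.ne_zero i) (hx.sub_inv_ne_zero i)
        (hx.succ i ▸ hx.sub_inv_ne_zero (i + 1)) (hae i)
  have hdown' : ∀ i, ladder q b c (weight q σ i)⁻¹ (e i) = t (i - 1) • e (i - 1) := fun i => by
    simpa only [sub_add_cancel] using hdown (i - 1)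
  let φ : V →ₗ[ℂ] M := v.constr ℂ e
  have hφ : ∀ i, φ (v i) = e i := fun i => v.constr_basis ..
  refine ⟨σ, s, t, ρ, φ, hρ, by rwa [hφ, he0], fun x => ?_⟩
  induction x using skein_induction with
  | hc m =>
    refine LinearMap.congr_fun (f := φ ∘ₗ ρ (curve q m)) (g := π (curve q m) ∘ₗ φ)
      (v.ext fun i => ?_)
    rw [LinearMap.comp_apply, LinearMap.comp_apply, hφ]
    cases m with
    | zero => rw [h0, diagOp_apply, map_smul, hφ, hae]
    | infty =>
      rw [h1, hop_apply, map_add, map_smul, map_smul, hφ, hφ, ← hup, ← hdown']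
      exact (infty_apply_eq hq (hx.sub_inv_ne_zero i) _).symm
    | one =>
      have e1 : q⁻¹ * (q⁻¹ ^ 2 * weight q σ i)⁻¹ = q * (weight q σ i)⁻¹ := by
        have := hx.ne_zero i
        field_simp
      rw [h2, hopOne, hop_apply, map_add, map_smul, map_smul, hφ, hφ, hx.pred hq, e1, mul_smul,
        mul_smul (q * (weight q σ i)⁻¹), ← hup, ← hdown']
      exact (one_apply_eq hq (hx.ne_zero i) (hx.sub_inv_ne_zero i) _).symm
  | h1 z => intro y; simp [Module.algebraMap_end_apply]
  | hadd x x' hx hx' => intro y; simp [hx, hx']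
  | hmul x x' hx hx' => intro y; simp [hx, hx']

/-- A type-`0` representation mapping nontrivially to a representation with classical shadow `χ` has
classical shadow `χ`. -/
theorem exists_isTypeZero_of_isClassicalShadow {q : ℂ} (hq : q ≠ 0) [NeZero (ordTwo q)]
    {V M : Type*} [AddCommGroup V] [Module ℂ V] [AddCommGroup M] [Module ℂ M]
    [FiniteDimensional ℂ M] [Nontrivial M] (v : Module.Basis (ZMod (ordTwo q)) ℂ V)
    {π : Skein q →ₐ[ℂ] Module.End ℂ M} {χ : Center q →ₐ[ℂ] ℂ} (h : IsClassicalShadow q π χ)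
    (hA : threadedCurve q .zero ∈ Center q) (hg : IsGeneral q (χ ⟨_, hA⟩)) :
    ∃ (σ w : ℂ) (s t : ZMod (ordTwo q) → ℂ) (ρ : Skein q →ₐ[ℂ] Module.End ℂ V),
      IsTypeZero q v σ w s t ρ ∧ IsClassicalShadow q ρ χ := by
  obtain ⟨σ, s, t, ρ, φ, hρ, h0, hφ⟩ := exists_intertwiner hq v π
    (h ⟨_, peripheral_mem_center hq⟩) (h ⟨_, hA⟩) hg
  refine ⟨σ, _, s, t, ρ, hρ, fun x => ?_⟩
  obtain ⟨k, hk⟩ := hρ.exists_eq_smul_one hq x.2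
  have := hφ x (v 0)
  rw [h x, hk, LinearMap.smul_apply, LinearMap.smul_apply, map_smul] at this
  rw [hk, smul_left_injective ℂ h0 this]

end PuncturedTorus

end

open PuncturedTorus in
theorem lemma4p6 (q : ℂ) (hq : IsOfFinOrder q) (hq4 : q ^ 4 ≠ 1)
    {V : Type*} [AddCommGroup V] [Module ℂ V] (v : Module.Basis (ZMod (ordTwo q)) ℂ V) :
    -- the elements `A_m` and `p` are central
    ∃ (hA : ∀ m : Slope, threadedCurve q m ∈ Center q) (hp : peripheral q ∈ Center q),
    -- every type-0 representation has a classical shadow, and `A_1`, `A_∞` act by the formulas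
    (∀ (σ w : ℂ) (s t : ZMod (ordTwo q) → ℂ) (ρ : Skein q →ₐ[ℂ] Module.End ℂ V),
      IsTypeZero q v σ w s t ρ →
      (∃ χ : Center q →ₐ[ℂ] ℂ, IsClassicalShadow q ρ χ) ∧
      (Odd (ordTwo q) →
        ρ (threadedCurve q .one) =
          (eps q * σ ^ ordTwo q * cycleProd q s + eps q * σ⁻¹ ^ ordTwo q * cycleProd q t) •
            (1 : Module.End ℂ V) ∧
        ρ (threadedCurve q .infty) =
          (cycleProd q s + cycleProd q t) • (1 : Module.End ℂ V)) ∧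
      (Even (ordTwo q) →
        ρ (threadedCurve q .one) =
          (σ ^ ordTwo q * cycleProd q s + σ⁻¹ ^ ordTwo q * cycleProd q t
            + corr q (zZero q σ) w) • (1 : Module.End ℂ V) ∧
        ρ (threadedCurve q .infty) =
          (cycleProd q s + cycleProd q t + corr q (zZero q σ) w) • (1 : Module.End ℂ V))) ∧
    -- every point of `MaxSpec Z` with general `z₀` is the shadow of a type-0 representation
    (∀ χ : Center q →ₐ[ℂ] ℂ, IsGeneral q (χ ⟨threadedCurve q .zero, hA .zero⟩) →
      ∃ (σ w : ℂ) (s t : ZMod (ordTwo q) → ℂ) (ρ : Skein q →ₐ[ℂ] Module.End ℂ V),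
        IsTypeZero q v σ w s t ρ ∧ IsClassicalShadow q ρ χ) ∧
    -- the same in the coordinates `(A_0, A_1, A_∞, p)` of the shadow variety in `ℂ⁴`
    (∀ z₀ z₁ zi w : ℂ, IsShadowPoint q z₀ z₁ zi w → IsGeneral q z₀ →
      ∃ (σ : ℂ) (s t : ZMod (ordTwo q) → ℂ) (ρ : Skein q →ₐ[ℂ] Module.End ℂ V)
        (χ : Center q →ₐ[ℂ] ℂ),
        IsTypeZero q v σ w s t ρ ∧ IsClassicalShadow q ρ χ ∧
        χ ⟨threadedCurve q .zero, hA .zero⟩ = z₀ ∧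
        χ ⟨threadedCurve q .one, hA .one⟩ = z₁ ∧
        χ ⟨threadedCurve q .infty, hA .infty⟩ = zi ∧
        χ ⟨peripheral q, hp⟩ = w) := by
  have hq0 := ne_zero_of_isOfFinOrder hq
  have hκ := sq_sub_inv_sq_ne_zero hq0 hq4
  have : NeZero (ordTwo q) := ⟨(ordTwo_pos hq).ne'⟩
  have hA := threadedCurve_mem_center hq0 hκ
  refine ⟨hA, peripheral_mem_center hq0, fun σ w s t ρ h => ⟨h.exists_isClassicalShadow hq0,
    h.apply_threadedCurve_of_odd hq hκ, h.apply_threadedCurve_of_even hq hκ⟩, fun χ hg => ?_,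
    fun z₀ z₁ zi w hz hg => ?_⟩
  · obtain ⟨M, _, _, _, _, π, hπ⟩ := exists_rep_of_center_character hq hκ χ
    exact exists_isTypeZero_of_isClassicalShadow hq0 v hπ (hA .zero) hg
  · obtain ⟨σ, s, t, ρ, h, h0, h1, hi⟩ := exists_isTypeZero_of_isShadowPoint hq hκ v hz hg
    obtain ⟨χ, hχ⟩ := h.exists_isClassicalShadow hq0
    have : Nontrivial V := ⟨v 0, 0, v.ne_zero 0⟩
    have hscalar : ∀ (x : Center q) (z : ℂ), ρ x = z • (1 : Module.End ℂ V) → χ x = z :=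
      fun x z hx => smul_left_injective ℂ one_ne_zero ((hχ x).symm.trans hx)
    exact ⟨σ, s, t, ρ, χ, h, hχ, hscalar _ _ h0, hscalar _ _ h1, hscalar _ _ hi,
      hscalar _ _ (h.apply_peripheral hq0)⟩
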